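/- Let $\mathcal{C}=\mathbb{R}/2\pi\mathbb{Z}\times(-\frac{\pi}{2},\frac{\pi}{2})$ be the cylinder with coordinates $(\psi,\varphi)$. Let $L,M:\mathcal{C}\to\mathbb{R}$ be the reduced averaged minimum-time Hamiltonians (for full control and for tangential thrust, respectively) $$L(\psi,\varphi)=\frac1\pi\int_0^\pi\sqrt{\widetilde I(\psi,\varphi,E)}\,\mathrm{d}E,\qquad M(\psi,\varphi)=\frac1\pi\int_0^\pi\bigl|\widetilde J(\psi,\varphi,E)\bigr|\,\mathrm{d}E,$$ where $$\widetilde I=\alpha^{1,1}\cos^2\psi+2\,\alpha^{1,2}\cos\psi\sin\psi+\alpha^{2,2}\sin^2\psi,$$ $$\alpha^{1,1}=1-\sin^2\varphi\cos^2E,\qquad \alpha^{1,2}=-2\cos\varphi\,(1-\sin\varphi\cos E)\cos E,$$ $$\alpha^{2,2}=(1-\sin\varphi\cos E)\,(1-3\sin\varphi\cos E+3\cos^2E-\sin\varphi\cos^3E),$$ $$\widetilde J=\sqrt{\frac{1-\sin\varphi\cos E}{1+\sin\varphi\cos E}}\,\Bigl((2\cos\varphi\sin\psi-\sin\varphi\cos\psi)\cos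 E-\cos\psi\Bigr).$$ Let $$\mathcal{S}=\Bigl\{(\psi,\varphi)\in\mathcal{C}:\ \tan\psi=\frac{1+\sin\varphi}{2\cos\varphi}\Bigr\}\cup\Bigl\{(\psi,\varphi)\in\mathcal{C}:\ \tan\psi=\frac{-1+\sin\varphi}{2\cos\varphi}\Bigr\}.$$ Then: 1. $L$ and $M$ are real analytic on $\mathcal{C}\setminus\mathcal{S}$. 2. $L$ and $M$ are continuously differentiable on $\mathcal{C}$. 3. For every $\xi\in\mathcal{S}$, neither $\mathrm{d}L$ nor $\mathrm{d}M$ is Lipschitz continuous on any neighbourhood of $\xi$. 4. For every $\xi\in\mathcal{S}$ there are constants $k>0$ and $r\in(0,1)$ such that, in the coordinates $(\psi,\varphi)$, for all $\eta$ with $\|\eta-\xi\|<r$ (in particular for $\eta=\xi$) and all $\delta\in\mathbb{R}^2$ with $\|\delta\|<r$, $$\|\mathrm{d}L(\eta+\delta)-\mathrm{d}L(\eta)\|\le k\,\|\delta\|\,\ln(1/\|\delta\|),\qquad \|\mathrm{d}M(\eta+\delta)-\mathrm{d}M(\eta)\|\le k\,\|\delta\|^{1/2},$$ where the first right-hand side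 is read as $0$ for $\delta=0$. -/

import Mathlib

open MeasureTheory Set Filter Topology
open scoped NNReal

noncomputable section

namespace AveragedTransfer

/-- The cylinder `(ℝ / 2πℤ) × (-π/2, π/2)`, as an open subset of `(ℝ / 2πℤ) × ℝ`. -/
def cylinder : Set (Real.Angle × ℝ) :=
  univ ×ˢ Ioo (-(Real.pi / 2)) (Real.pi / 2)

/-- The coefficient `α¹¹(φ, c)`, with `c = cos E`. -/
def alpha11 (φ c : ℝ) : ℝ := 1 - Real.sin φ ^ 2 * c ^ 2

/-- The coefficient `α¹²(φ, c)`, with `c = cos E`. -/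
def alpha12 (φ c : ℝ) : ℝ := -2 * Real.cos φ * (1 - Real.sin φ * c) * c

/-- The coefficient `α²²(φ, c)`, with `c = cos E`. -/
def alpha22 (φ c : ℝ) : ℝ :=
  (1 - Real.sin φ * c) * (1 - 3 * Real.sin φ * c + 3 * c ^ 2 - Real.sin φ * c ^ 3)

/-- The quadratic form under the square root, two-input (full control) case. -/
def tildeI (ψ : Real.Angle) (φ E : ℝ) : ℝ :=
  alpha11 φ (Real.cos E) * ψ.cos ^ 2
    + 2 * alpha12 φ (Real.cos E) * ψ.cos * ψ.sin
    + alpha22 φ (Real.cos E) * ψ.sin ^ 2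

/-- The linear form inside the absolute value, single-input (tangential thrust) case. -/
def tildeJ (ψ : Real.Angle) (φ E : ℝ) : ℝ :=
  Real.sqrt ((1 - Real.sin φ * Real.cos E) / (1 + Real.sin φ * Real.cos E))
    * ((2 * Real.cos φ * ψ.sin - Real.sin φ * ψ.cos) * Real.cos E - ψ.cos)

/-- The reduced averaged minimum-time Hamiltonian, full control (of interest on `cylinder`). -/
def L (ξ : Real.Angle × ℝ) : ℝ :=
  1 / Real.pi * ∫ E in (0 : ℝ)..Real.pi, Real.sqrt (tildeI ξ.1 ξ.2 E)

/-- The reduced averaged minimum-time Hamiltonian, tangential thrust (of interest on `cylinder`). -/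
def M (ξ : Real.Angle × ℝ) : ℝ :=
  1 / Real.pi * ∫ E in (0 : ℝ)..Real.pi, |tildeJ ξ.1 ξ.2 E|

/-- The union of the curves `tan ψ = (1 + sin φ) / (2 cos φ)` and
`tan ψ = (-1 + sin φ) / (2 cos φ)` on the cylinder. -/
def singularSet : Set (Real.Angle × ℝ) :=
  {ξ | ξ ∈ cylinder ∧ ξ.1.cos ≠ 0 ∧
    (ξ.1.tan = (1 + Real.sin ξ.2) / (2 * Real.cos ξ.2) ∨
     ξ.1.tan = (-1 + Real.sin ξ.2) / (2 * Real.cos ξ.2))}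

/-- The universal covering `(ψ, φ) ↦ (ψ mod 2π, φ)`; its local inverses are the standard
charts `(ψ, φ)` of the cylinder. -/
def cover (x : ℝ × ℝ) : Real.Angle × ℝ := ((x.1 : Real.Angle), x.2)

/-- The expression of a function on the cylinder in the coordinates `(ψ, φ)`. Since `cover` is a
local analytic diffeomorphism, regularity of `f` at `cover x` is regularity of
`inCoords f` at `x`. -/
def inCoords (f : Real.Angle × ℝ → ℝ) : ℝ × ℝ → ℝ := fun x => f (cover x)

/-- The differential of a function on the cylinder, in the coordinates `(ψ, φ)`. -/
def differential (f : Real.Angle × ℝ → ℝ) : ℝ × ℝ → (ℝ × ℝ →L[ℝ] ℝ) :=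
  fderiv ℝ (inCoords f)

end AveragedTransfer

end

/-! The form under the square root is a sum of two squares, T² + N², where T (`tangential`) is the
expression inside the absolute value of M (`tildeI_eq`, `tildeJ_eq`). So L averages the Euclidean
norm of (T, N) and M averages |T|, and singularities come only from zeros of these. Up to a positive
weight, T is `lead` · cos E - cos ψ and N is a positive factor times sin ψ sin E. The singular
curves are exactly where T vanishes at E = 0 or E = π; there N vanishes too.

Off the curves (T, N) never vanishes, so L is analytic. T either has no zero in E, or changes sign
once, at an angle depending analytically on the point; cutting the integral there makes M analytic.

Near the curves one differentiates under the integral. The derivative pairs the unit vector along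
(T, N) with the derivatives of T and N. For a displacement d the unit vector moves by O(d / |(T,
N)|), and |(T, N)| ≥ c sin E since sin ψ ≠ 0; integrating min(1, d / sin E) gives d ln(1/d). For M
the unit vector is a sign, which can flip only where |T| = O(d). As cos E has quadratic critical
points at 0 and π, this set has measure O(√d). Both moduli tend to 0, which gives C¹.

A Lipschitz differential would force second differences of size O(t²). In the ψ direction T and N
are rotated: a shift by t gives cos t (T, N) + sin t (T', N'), the primes denoting a shift by π/2.
On the curve where the zero is at E = 0, T = O(E²), N = O(E), while the determinant T N' - N T' is
of order E. For L this yields a gain of order t²/E on t ≤ E ≤ 1, hence t² ln(1/t); for M a gain of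
order t on E ≤ a√t, hence t^(3/2). Both beat t². The reflection (ψ, φ, E) ↦ (π - ψ, -φ, π - E)
carries the result to the other curve. -/

/-! ### Analytic dependence of integrals on a parameter -/

/-- The power series at (x₀, t₀) is re-centred at (x₀, t), restricted to the directions of X, and
integrated in t coefficient by coefficient; a majorant of the re-centred coefficients, uniform in t,
justifies the exchange of sum and integral. -/
theorem AnalyticAt.exists_pos_analyticAt_intervalIntegral {X : Type*} [NormedAddCommGroup X]
    [NormedSpace ℝ X] {F : X × ℝ → ℝ} {x₀ : X} {t₀ : ℝ} (h : AnalyticAt ℝ F (x₀, t₀)) :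
    ∃ ε > 0, ∀ a ∈ Metric.ball t₀ ε, ∀ b ∈ Metric.ball t₀ ε,
      AnalyticAt ℝ (fun x => ∫ t in a..b, F (x, t)) x₀ := by
  obtain ⟨p, r, hp⟩ := h
  -- One ε is spent on moving the centre from t₀ to t, the other on the increment in X.
  obtain ⟨ε, hε0, hεr⟩ : ∃ ε : ℝ≥0, 0 < ε ∧ (ε + ε : ENNReal) < r := by
    obtain ⟨s, hs0, hsr⟩ := ENNReal.lt_iff_exists_nnreal_btwn.1 hp.r_pos
    refine ⟨s / 2, by positivity [show 0 < s by exact_mod_cast hs0], ?_⟩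
    rw [← ENNReal.coe_add, add_halves]
    exact hsr
  refine ⟨ε, hε0, fun a ha b hb => ?_⟩
  have hεrad : (ε + ε : ENNReal) < p.radius := hεr.trans_le hp.r_le
  have hab' : ∀ t ∈ uIcc a b, ‖t - t₀‖ < ε := by
    intro t h1
    have h2 := (convex_ball t₀ (ε : ℝ)).ordConnected.uIcc_subset ha hb h1
    simpa [dist_eq_norm] using h2
  have hab : ∀ t ∈ uIoc a b, ‖t - t₀‖ < ε := fun t ht => hab' t (uIoc_subset_uIcc ht)
  have hnn : ∀ t : ℝ, ‖((0 : X), t - t₀)‖ = ‖t - t₀‖ := by intro t; simp [Prod.norm_def]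
  set q : ℝ → (n : ℕ) → ContinuousMultilinearMap ℝ (fun _ : Fin n => X) ℝ := fun t n =>
    (p.changeOrigin ((0 : X), t - t₀) n).compContinuousLinearMap
      (fun _ => ContinuousLinearMap.inl ℝ X ℝ) with hq
  set B : ℕ → ℝ≥0 := fun n => ∑' s : Σ l : ℕ, { s : Finset (Fin (n + l)) // s.card = l },
    ‖p (n + s.1)‖₊ * ε ^ s.1 with hB
  have hBsum : Summable fun n => B n * ε ^ n := by
    simpa only [hB, ← NNReal.tsum_mul_right] using
      (NNReal.summable_sigma.1 (p.changeOriginSeries_summable_aux₁ hεrad)).2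
  have hBsum' : Summable fun n => (B n : ℝ) * (ε : ℝ) ^ n := by exact_mod_cast hBsum
  have hqB : ∀ n, ∀ t, ‖t - t₀‖ < ε → ‖q t n‖ ≤ B n := by
    intro n t ht
    have h0 : ‖((0 : X), t - t₀)‖₊ < ε := by
      rw [← NNReal.coe_lt_coe, coe_nnnorm, hnn]; exact ht
    have h0' : (‖((0 : X), t - t₀)‖₊ : ENNReal) < p.radius :=
      (ENNReal.coe_lt_coe.2 h0).trans_le ((le_add_right le_rfl).trans hεrad.le)
    have h1 := p.nnnorm_changeOrigin_le n h0'
    have h2 : ‖p.changeOrigin ((0 : X), t - t₀) n‖₊ ≤ B n := by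
      refine h1.trans ?_
      refine Summable.tsum_le_tsum (fun s => ?_) (p.changeOriginSeries_summable_aux₂ h0' n)
        (p.changeOriginSeries_summable_aux₂ ((le_add_right le_rfl).trans_lt hεrad) n)
      gcongr
    refine (ContinuousMultilinearMap.norm_compContinuousLinearMap_le _ _).trans ?_
    have h3 : ∏ _i : Fin n, ‖ContinuousLinearMap.inl ℝ X ℝ‖ ≤ 1 :=
      Finset.prod_le_one (fun _ _ => norm_nonneg _)
        (fun _ _ => ContinuousLinearMap.norm_inl_le_one ℝ X ℝ)
    calc _ ≤ ‖p.changeOrigin ((0 : X), t - t₀) n‖ * 1 := by gcongr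
      _ ≤ B n := by rw [mul_one]; exact_mod_cast h2
  have hqcont : ∀ n, ContinuousOn (fun t => q t n) (uIcc a b) := by
    intro n
    have hrad : 0 < p.radius := hp.r_pos.trans_le hp.r_le
    have h1 := (p.hasFPowerSeriesOnBall_changeOrigin n hrad).continuousOn
    have h2 : ContinuousOn (fun t : ℝ => p.changeOrigin ((0 : X), t - t₀) n) (uIcc a b) := by
      refine h1.comp (f := fun t : ℝ => ((0 : X), t - t₀)) (by fun_prop) ?_
      intro t ht
      rw [mem_eball_zero_iff]
      have h0 : ‖((0 : X), t - t₀)‖₊ < ε := by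
        rw [← NNReal.coe_lt_coe, coe_nnnorm, hnn]; exact hab' t ht
      exact (ENNReal.coe_lt_coe.2 h0).trans_le ((le_add_right le_rfl).trans hεrad.le)
    exact (ContinuousMultilinearMap.compContinuousLinearMapL
      (fun _ : Fin n => ContinuousLinearMap.inl ℝ X ℝ)).continuous.comp_continuousOn h2
  have hqint : ∀ n, IntervalIntegrable (fun t => q t n) volume a b := fun n =>
    (hqcont n).intervalIntegrable
  refine ⟨fun n => ∫ t in a..b, q t n, ε, ?_, by exact_mod_cast hε0, ?_⟩
  · apply FormalMultilinearSeries.le_radius_of_summable_norm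
    refine Summable.of_nonneg_of_le (fun n => by positivity) (fun n => ?_)
      (hBsum'.mul_left |b - a|)
    have := intervalIntegral.norm_integral_le_of_norm_le_const (a := a) (b := b)
      (fun t ht => hqB n t (hab t ht))
    calc _ ≤ ((B n : ℝ) * |b - a|) * (ε : ℝ) ^ n := by gcongr
      _ = _ := by ring
  · intro y hy
    have hy' : ‖y‖ < ε := by simpa using hy
    have key : ∀ n, (∫ t in a..b, q t n) (fun _ => y) = ∫ t in a..b, q t n (fun _ => y) := by
      intro n
      exact ((ContinuousMultilinearMap.apply ℝ (fun _ : Fin n => X) ℝ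
        (fun _ => y)).intervalIntegral_comp_comm (hqint n)).symm
    simp only [key]
    refine intervalIntegral.hasSum_integral_of_dominated_convergence
      (fun n _ => (B n : ℝ) * (ε : ℝ) ^ n) ?_ ?_ ?_ ?_ ?_
    · intro n
      have : ContinuousOn (fun t => q t n (fun _ => y)) (uIcc a b) :=
        (ContinuousMultilinearMap.apply ℝ (fun _ : Fin n => X) ℝ
          (fun _ => y)).continuous.comp_continuousOn (hqcont n)
      exact (this.mono uIoc_subset_uIcc).aestronglyMeasurable measurableSet_uIoc
    · refine fun n => Eventually.of_forall fun t ht => ?_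
      refine ((q t n).le_opNorm _).trans ?_
      rw [Fin.prod_const]
      have := hqB n t (hab t ht)
      gcongr
    · exact Eventually.of_forall fun t ht => hBsum'
    · exact intervalIntegrable_const
    · refine Eventually.of_forall fun t ht => ?_
      have h0 : ‖((0 : X), t - t₀)‖₊ < ε := by
        rw [← NNReal.coe_lt_coe, coe_nnnorm, hnn]; exact hab t ht
      have h0' : ‖((0 : X), t - t₀)‖ₑ < ε := ENNReal.coe_lt_coe.2 h0
      have h1 := hp.changeOrigin (y := ((0 : X), t - t₀))
        (h0'.trans_le ((le_add_right le_rfl).trans hεr.le))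
      have h2 := h1.hasSum (y := (y, 0)) (by
        rw [mem_eball_zero_iff, lt_tsub_iff_left]
        refine lt_of_le_of_lt (add_le_add h0'.le ?_) hεr
        have : ‖(y, (0 : ℝ))‖₊ ≤ ε := by
          rw [← NNReal.coe_le_coe, coe_nnnorm]; simpa [Prod.norm_def] using hy'.le
        exact ENNReal.coe_le_coe.2 this)
      simpa [hq] using h2

/-- Compactness of the interval: a subdivision fine enough for the local statement to apply on each
piece, then a finite sum. The tube lemma supplies integrability on all pieces for nearby x at once.
-/
theorem analyticAt_intervalIntegral_of_forall_mem_Icc {X : Type*} [NormedAddCommGroup X]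
    [NormedSpace ℝ X] {F : X × ℝ → ℝ} {x₀ : X} {a b : ℝ} (hab : a ≤ b)
    (h : ∀ t ∈ Icc a b, AnalyticAt ℝ F (x₀, t)) :
    AnalyticAt ℝ (fun x => ∫ t in a..b, F (x, t)) x₀ := by
  choose! ε hε hF using fun t ht => (h t ht).exists_pos_analyticAt_intervalIntegral
  obtain ⟨u, hu, hu'⟩ : ∃ u ∈ 𝓝 x₀, ∀ x ∈ u, ContinuousOn (fun t => F (x, t)) (Icc a b) := by
    obtain ⟨u, v, hu, -, hxu, hv, huv⟩ := generalized_tube_lemma (isCompact_singleton (x := x₀))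
      (isCompact_Icc (a := a) (b := b)) (isOpen_analyticAt ℝ F) (by
        rintro ⟨x, t⟩ ⟨hx, ht⟩
        obtain rfl : x = x₀ := hx
        exact h t ht)
    refine ⟨u, hu.mem_nhds (hxu rfl), fun x hx t ht => ?_⟩
    have h1 : AnalyticAt ℝ F (x, t) := huv ⟨hx, hv ht⟩
    have h2 : ContinuousAt (fun t => F (x, t)) t :=
      ContinuousAt.comp (g := F) (f := fun t => (x, t)) h1.continuousAt (by fun_prop)
    exact h2.continuousWithinAt
  obtain ⟨t, ht0, htm, ⟨m, hm⟩, ht⟩ := exists_monotone_Icc_subset_open_cover_Icc hab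
    (c := fun s : Icc a b => {z : Icc a b | (z : ℝ) ∈ Metric.ball (s : ℝ) (ε s)})
    (fun s => Metric.isOpen_ball.preimage continuous_subtype_val)
    (fun z _ => mem_iUnion.2 ⟨z, Metric.mem_ball_self (hε z z.2)⟩)
  have step : ∀ n, AnalyticAt ℝ (fun x => ∫ s in a..(t n : ℝ), F (x, s)) x₀ := by
    intro n
    induction n with
    | zero =>
      simp only [ht0, intervalIntegral.integral_same]
      exact analyticAt_const
    | succ n ih =>
      obtain ⟨i, hi⟩ := ht n
      have h1 := hF i i.2 (t n) (hi ⟨le_rfl, htm n.le_succ⟩) (t (n + 1))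
        (hi ⟨htm n.le_succ, le_rfl⟩)
      refine (ih.add h1).congr ?_
      filter_upwards [hu] with x hx
      refine intervalIntegral.integral_add_adjacent_intervals ?_ ?_
      · refine ((hu' x hx).mono ?_).intervalIntegrable
        rw [uIcc_of_le (t n).2.1]
        exact Icc_subset_Icc le_rfl (t n).2.2
      · refine ((hu' x hx).mono ?_).intervalIntegrable
        rw [uIcc_of_le (show (t n : ℝ) ≤ t (n + 1) from htm n.le_succ)]
        exact Icc_subset_Icc (t n).2.1 (t (n+1)).2.2
  simpa [hm m le_rfl] using step m

/-! ### Differentiating the integral of a Euclidean norm, and the two moduli -/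

/-- A family `J · E`, `E ∈ [0, π]`, of functions on `s` that are differentiable with derivatives
`J' · E`, bounded by `B` and `B`-Lipschitz uniformly in `E`. -/
structure UniformC11On {X : Type*} [NormedAddCommGroup X] [NormedSpace ℝ X] (J : X → ℝ → ℝ)
    (J' : X → ℝ → X →L[ℝ] ℝ) (s : Set X) (B : ℝ) : Prop where
  hasFDerivAt : ∀ x ∈ s, ∀ E ∈ Icc 0 Real.pi, HasFDerivAt (fun x => J x E) (J' x E) x
  continuousOn : ∀ x ∈ s, ContinuousOn (J x) (Icc 0 Real.pi)
  continuousOn_deriv : ∀ x ∈ s, ContinuousOn (J' x) (Icc 0 Real.pi)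
  norm_deriv_le : ∀ x ∈ s, ∀ E ∈ Icc 0 Real.pi, ‖J' x E‖ ≤ B
  norm_deriv_sub_le : ∀ x ∈ s, ∀ y ∈ s, ∀ E ∈ Icc 0 Real.pi, ‖J' x E - J' y E‖ ≤ B * ‖x - y‖

namespace UniformC11On

variable {X : Type*} [NormedAddCommGroup X] [NormedSpace ℝ X] {J N : X → ℝ → ℝ}
  {J' N' : X → ℝ → X →L[ℝ] ℝ} {s : Set X} {B : ℝ}

theorem mono (h : UniformC11On J J' s B) {t : Set X} {C : ℝ} (ht : t ⊆ s) (hC : B ≤ C) :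
    UniformC11On J J' t C where
  hasFDerivAt x hx := h.hasFDerivAt x (ht hx)
  continuousOn x hx := h.continuousOn x (ht hx)
  continuousOn_deriv x hx := h.continuousOn_deriv x (ht hx)
  norm_deriv_le x hx E hE := (h.norm_deriv_le x (ht hx) E hE).trans hC
  norm_deriv_sub_le x hx y hy E hE :=
    (h.norm_deriv_sub_le x (ht hx) y (ht hy) E hE).trans (by gcongr)

theorem zero (hB : 0 ≤ B) : UniformC11On (fun (_ : X) _ => 0) (fun _ _ => 0) s B where
  hasFDerivAt x _ _ _ := hasFDerivAt_const 0 x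
  continuousOn _ _ := continuousOn_const
  continuousOn_deriv _ _ := continuousOn_const
  norm_deriv_le _ _ _ _ := by simpa using hB
  norm_deriv_sub_le x _ y _ _ _ := by simpa using by positivity

theorem nonneg (h : UniformC11On J J' s B) {x : X} (hx : x ∈ s) : 0 ≤ B :=
  (norm_nonneg _).trans (h.norm_deriv_le x hx 0 ⟨le_rfl, Real.pi_pos.le⟩)

theorem abs_sub_le (h : UniformC11On J J' s B) (hs : Convex ℝ s) {x y : X} (hx : x ∈ s)
    (hy : y ∈ s) {E : ℝ} (hE : E ∈ Icc 0 Real.pi) : |J x E - J y E| ≤ B * ‖x - y‖ := by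
  have := hs.norm_image_sub_le_of_norm_hasFDerivWithin_le
    (fun z hz => (h.hasFDerivAt z hz E hE).hasFDerivWithinAt)
    (fun z hz => h.norm_deriv_le z hz E hE) hy hx
  simpa using this

end UniformC11On

theorem abs_div_sqrt_add_sq_le_one (a b : ℝ) : |a / √(a ^ 2 + b ^ 2)| ≤ 1 := by
  rw [abs_div, abs_of_nonneg (Real.sqrt_nonneg _)]
  refine div_le_one_of_le₀ (Real.abs_le_sqrt (by nlinarith [sq_nonneg b])) (Real.sqrt_nonneg _)

theorem abs_sqrt_add_sq_sub_le (a b c d : ℝ) :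
    |√(a ^ 2 + b ^ 2) - √(c ^ 2 + d ^ 2)| ≤ |a - c| + |b - d| := by
  have key : ∀ a b : ℝ, √(a ^ 2 + b ^ 2) = ‖(⟨a, b⟩ : ℂ)‖ := by
    intro a b
    rw [Complex.norm_def, Complex.normSq_mk]; ring_nf
  rw [key, key]
  refine (abs_norm_sub_norm_le _ _).trans ((Complex.norm_le_abs_re_add_abs_im _).trans ?_)
  simp

/-- Radial projection onto the unit circle is Lipschitz with constant of order 1/norm. The product
form, with the norm at one endpoint only, stays true at the origin, where division by zero returns
0. -/
theorem abs_div_sqrt_sub_div_sqrt_mul_le (a b c d : ℝ) :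
    |a / √(a ^ 2 + b ^ 2) - c / √(c ^ 2 + d ^ 2)| * √(a ^ 2 + b ^ 2)
      ≤ 2 * |a - c| + |b - d| := by
  set S := √(a ^ 2 + b ^ 2) with hS
  set T := √(c ^ 2 + d ^ 2) with hT
  rcases (Real.sqrt_nonneg (a ^ 2 + b ^ 2)).eq_or_lt with h | h
  · rw [hS, ← h]; simp; positivity
  rw [← hS] at h
  have h1 : |c / T| ≤ 1 := abs_div_sqrt_add_sq_le_one c d
  have h2 : |T - S| ≤ |a - c| + |b - d| := by
    rw [abs_sub_comm]; exact abs_sqrt_add_sq_sub_le a b c d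
  have h3 : c / T * T = c := by
    rcases (Real.sqrt_nonneg (c ^ 2 + d ^ 2)).eq_or_lt with h' | h'
    · have : c ^ 2 + d ^ 2 = 0 := (Real.sqrt_eq_zero (by positivity)).1 h'.symm
      have hc : c = 0 := by nlinarith [sq_nonneg c, sq_nonneg d]
      simp [hc]
    · exact div_mul_cancel₀ _ (by rw [hT]; exact h'.ne')
  calc |a / S - c / T| * S = |(a - c) + c / T * (T - S)| := by
        rw [← abs_of_pos h, ← abs_mul, abs_of_pos h]
        congr 1
        rw [mul_sub, h3, sub_mul, div_mul_cancel₀ _ h.ne']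
        ring
    _ ≤ |a - c| + |c / T| * |T - S| := by rw [← abs_mul]; exact abs_add_le _ _
    _ ≤ |a - c| + 1 * (|a - c| + |b - d|) := by gcongr
    _ = _ := by ring

section normIntegral

variable {X : Type*} [NormedAddCommGroup X] [NormedSpace ℝ X]

/-- The derivative in `x` of `√(J x E ^ 2 + N x E ^ 2)`. -/
noncomputable def sqrtSumSqDeriv (J N : X → ℝ → ℝ) (J' N' : X → ℝ → X →L[ℝ] ℝ) (x : X) (E : ℝ) :
    X →L[ℝ] ℝ :=
  (J x E / √(J x E ^ 2 + N x E ^ 2)) • J' x E + (N x E / √(J x E ^ 2 + N x E ^ 2)) • N' x E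

variable {J N : X → ℝ → ℝ} {J' N' : X → ℝ → X →L[ℝ] ℝ} {s : Set X} {B : ℝ}

theorem aestronglyMeasurable_sqrtSumSqDeriv (hJ : UniformC11On J J' s B)
    (hN : UniformC11On N N' s B) {x : X} (hx : x ∈ s) :
    AEStronglyMeasurable (sqrtSumSqDeriv J N J' N' x) (volume.restrict (Icc 0 Real.pi)) := by
  have h1 := (hJ.continuousOn x hx).aestronglyMeasurable (μ := volume) measurableSet_Icc
  have h2 := (hN.continuousOn x hx).aestronglyMeasurable (μ := volume) measurableSet_Icc
  have h3 := (hJ.continuousOn_deriv x hx).aestronglyMeasurable_of_isCompact (μ := volume)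
    isCompact_Icc measurableSet_Icc
  have h4 := (hN.continuousOn_deriv x hx).aestronglyMeasurable_of_isCompact (μ := volume)
    isCompact_Icc measurableSet_Icc
  have h5 : AEStronglyMeasurable (fun E => (√(J x E ^ 2 + N x E ^ 2))⁻¹)
      (volume.restrict (Icc 0 Real.pi)) :=
    (Real.continuous_sqrt.comp_aestronglyMeasurable
      ((h1.pow 2).add (h2.pow 2))).aemeasurable.inv.aestronglyMeasurable
  have e : sqrtSumSqDeriv J N J' N' x = fun E =>
      (J x E * (√(J x E ^ 2 + N x E ^ 2))⁻¹) • J' x E +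
        (N x E * (√(J x E ^ 2 + N x E ^ 2))⁻¹) • N' x E := by
    funext E
    simp only [sqrtSumSqDeriv, div_eq_mul_inv]
  rw [e]
  exact ((h1.mul h5).smul h3).add ((h2.mul h5).smul h4)

theorem norm_sqrtSumSqDeriv_le (hJ : UniformC11On J J' s B) (hN : UniformC11On N N' s B) {x : X}
    (hx : x ∈ s) {E : ℝ} (hE : E ∈ Icc 0 Real.pi) : ‖sqrtSumSqDeriv J N J' N' x E‖ ≤ 2 * B := by
  have h1 := abs_div_sqrt_add_sq_le_one (J x E) (N x E)
  have h2 := abs_div_sqrt_add_sq_le_one (N x E) (J x E)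
  rw [add_comm] at h2
  have h3 := hJ.norm_deriv_le x hx E hE
  have h4 := hN.norm_deriv_le x hx E hE
  refine (norm_add_le _ _).trans ?_
  rw [norm_smul, norm_smul, Real.norm_eq_abs, Real.norm_eq_abs]
  calc _ ≤ 1 * B + 1 * B := by gcongr
    _ = _ := by ring

theorem intervalIntegrable_sqrtSumSqDeriv (hJ : UniformC11On J J' s B)
    (hN : UniformC11On N N' s B) {x : X} (hx : x ∈ s) :
    IntervalIntegrable (sqrtSumSqDeriv J N J' N' x) volume 0 Real.pi := by
  rw [intervalIntegrable_iff_integrableOn_Icc_of_le Real.pi_pos.le]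
  refine Integrable.of_bound (aestronglyMeasurable_sqrtSumSqDeriv hJ hN hx) (2 * B) ?_
  filter_upwards [self_mem_ae_restrict measurableSet_Icc] with E hE
  exact norm_sqrtSumSqDeriv_le hJ hN hx hE

/-- The integrand is Lipschitz in x uniformly in E, so dominated differentiation tolerates a null
set of E at which the norm is not differentiable. This is what makes the formula available on the
singular set itself. -/
theorem hasFDerivAt_integral_sqrt_sum_sq (hJ : UniformC11On J J' s B)
    (hN : UniformC11On N N' s B) (hs : Convex ℝ s) {x : X} (hx : s ∈ 𝓝 x)
    (h0 : ∀ᵐ E, E ∈ Ioc 0 Real.pi → J x E ^ 2 + N x E ^ 2 ≠ 0) :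
    HasFDerivAt (fun x => ∫ E in (0 : ℝ)..Real.pi, √(J x E ^ 2 + N x E ^ 2))
      (∫ E in (0 : ℝ)..Real.pi, sqrtSumSqDeriv J N J' N' x E) x := by
  have hI : Set.uIoc 0 Real.pi = Ioc 0 Real.pi := uIoc_of_le Real.pi_pos.le
  have hcont : ∀ y ∈ s, ContinuousOn (fun E => √(J y E ^ 2 + N y E ^ 2)) (Icc 0 Real.pi) :=
    fun y hy => Real.continuous_sqrt.comp_continuousOn
      (((hJ.continuousOn y hy).pow 2).add ((hN.continuousOn y hy).pow 2))
  have hB := hJ.nonneg (mem_of_mem_nhds hx)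
  refine (intervalIntegral.hasFDerivAt_integral_of_dominated_loc_of_lip
    (bound := fun _ => 2 * B) (s := s) hx ?_ ?_ ?_ ?_ ?_ ?_).2
  · filter_upwards [hx] with y hy
    rw [hI]
    exact ((hcont y hy).mono Ioc_subset_Icc_self).aestronglyMeasurable measurableSet_Ioc
  · refine ContinuousOn.intervalIntegrable ?_
    rw [uIcc_of_le Real.pi_pos.le]
    exact hcont x (mem_of_mem_nhds hx)
  · rw [hI]
    exact (aestronglyMeasurable_sqrtSumSqDeriv hJ hN (mem_of_mem_nhds hx)).mono_set
      Ioc_subset_Icc_self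
  · refine Eventually.of_forall fun E hE => ?_
    have hE' : E ∈ Icc 0 Real.pi := Ioc_subset_Icc_self (hI ▸ hE)
    refine LipschitzOnWith.of_dist_le_mul fun y hy z hz => ?_
    rw [Real.coe_nnabs, abs_of_nonneg (by positivity), Real.dist_eq, dist_eq_norm]
    refine (abs_sqrt_add_sq_sub_le _ _ _ _).trans ?_
    have h1 := hJ.abs_sub_le hs hy hz hE'
    have h2 := hN.abs_sub_le hs hy hz hE'
    linarith
  · exact intervalIntegrable_const
  · filter_upwards [h0] with E h0 hE
    rw [hI] at hE
    have hE' : E ∈ Icc 0 Real.pi := Ioc_subset_Icc_self hE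
    have h1 := hJ.hasFDerivAt x (mem_of_mem_nhds hx) E hE'
    have h2 := hN.hasFDerivAt x (mem_of_mem_nhds hx) E hE'
    have h3 := ((h1.pow 2).add (h2.pow 2)).sqrt (h0 hE)
    refine h3.congr_fderiv ?_
    have h4 : √(J x E ^ 2 + N x E ^ 2) ≠ 0 := by
      rw [Real.sqrt_ne_zero (by positivity)]; exact h0 hE
    ext v
    simp [sqrtSumSqDeriv]
    field_simp

/-- The variation of `J'` and `N'` against a unit vector costs 2B‖x - y‖; the variation of each
component of the unit vector costs 3B‖x - y‖ divided by the norm, and multiplies a derivative of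
size at most B. -/
theorem norm_sqrtSumSqDeriv_sub_mul_le (hJ : UniformC11On J J' s B)
    (hN : UniformC11On N N' s B) (hs : Convex ℝ s) {x y : X} (hx : x ∈ s) (hy : y ∈ s) {E : ℝ}
    (hE : E ∈ Icc 0 Real.pi) :
    ‖sqrtSumSqDeriv J N J' N' x E - sqrtSumSqDeriv J N J' N' y E‖ * √(J x E ^ 2 + N x E ^ 2) ≤
      (2 * B * √(J x E ^ 2 + N x E ^ 2) + 6 * B ^ 2) * ‖x - y‖ := by
  have hB := hJ.nonneg hx
  set S := √(J x E ^ 2 + N x E ^ 2) with hS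
  have hS0 : 0 ≤ S := Real.sqrt_nonneg _
  set T := √(J y E ^ 2 + N y E ^ 2) with hT
  have h1 : |J x E / S - J y E / T| * S ≤ 3 * B * ‖x - y‖ := by
    have := abs_div_sqrt_sub_div_sqrt_mul_le (J x E) (N x E) (J y E) (N y E)
    have a1 := hJ.abs_sub_le hs hx hy hE
    have a2 := hN.abs_sub_le hs hx hy hE
    linarith
  have h2 : |N x E / S - N y E / T| * S ≤ 3 * B * ‖x - y‖ := by
    have := abs_div_sqrt_sub_div_sqrt_mul_le (N x E) (J x E) (N y E) (J y E)
    rw [add_comm (N x E ^ 2), add_comm (N y E ^ 2)] at this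
    have a1 := hJ.abs_sub_le hs hx hy hE
    have a2 := hN.abs_sub_le hs hx hy hE
    linarith
  have e : sqrtSumSqDeriv J N J' N' x E - sqrtSumSqDeriv J N J' N' y E =
      ((J x E / S) • (J' x E - J' y E) + (N x E / S) • (N' x E - N' y E)) +
      ((J x E / S - J y E / T) • J' y E + (N x E / S - N y E / T) • N' y E) := by
    simp only [sqrtSumSqDeriv, ← hS, ← hT]
    module
  have k1 : |J x E / S| ≤ 1 := abs_div_sqrt_add_sq_le_one _ _
  have k2 : |N x E / S| ≤ 1 := by
    have := abs_div_sqrt_add_sq_le_one (N x E) (J x E)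
    rwa [add_comm] at this
  have k3 := hJ.norm_deriv_le y hy E hE
  have k4 := hN.norm_deriv_le y hy E hE
  have k5 := hJ.norm_deriv_sub_le x hx y hy E hE
  have k6 := hN.norm_deriv_sub_le x hx y hy E hE
  have n1 : ‖sqrtSumSqDeriv J N J' N' x E - sqrtSumSqDeriv J N J' N' y E‖ ≤
      (1 * (B * ‖x - y‖) + 1 * (B * ‖x - y‖)) +
      (|J x E / S - J y E / T| * B + |N x E / S - N y E / T| * B) := by
    rw [e]
    refine (norm_add_le _ _).trans (add_le_add ((norm_add_le _ _).trans ?_)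
      ((norm_add_le _ _).trans ?_))
    · rw [norm_smul, norm_smul, Real.norm_eq_abs, Real.norm_eq_abs]; gcongr
    · rw [norm_smul, norm_smul, Real.norm_eq_abs, Real.norm_eq_abs]; gcongr
  calc _ ≤ ((1 * (B * ‖x - y‖) + 1 * (B * ‖x - y‖)) +
      (|J x E / S - J y E / T| * B + |N x E / S - N y E / T| * B)) * S := by gcongr
    _ = 2 * B * ‖x - y‖ * S + B * (|J x E / S - J y E / T| * S) +
      B * (|N x E / S - N y E / T| * S) := by ring
    _ ≤ 2 * B * ‖x - y‖ * S + B * (3 * B * ‖x - y‖) + B * (3 * B * ‖x - y‖) := by gcongr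
    _ = _ := by ring

theorem norm_sqrtSumSqDeriv_sub_le (hJ : UniformC11On J J' s B) (hN : UniformC11On N N' s B)
    {x y : X} (hx : x ∈ s) (hy : y ∈ s) {E : ℝ} (hE : E ∈ Icc 0 Real.pi) :
    ‖sqrtSumSqDeriv J N J' N' x E - sqrtSumSqDeriv J N J' N' y E‖ ≤ 4 * B := by
  have h1 := norm_sqrtSumSqDeriv_le hJ hN hx hE
  have h2 := norm_sqrtSumSqDeriv_le hJ hN hy hE
  have := norm_sub_le (sqrtSumSqDeriv J N J' N' x E) (sqrtSumSqDeriv J N J' N' y E)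
  linarith

/-- Jordan's inequality sin u ≥ 2u/π, applied from whichever endpoint is nearer; the right side has
an explicit logarithmic integral. -/
theorem inv_sin_add_le {d E : ℝ} (hd : 0 < d) (hE : E ∈ Icc 0 Real.pi) :
    (Real.sin E + d)⁻¹ ≤ Real.pi / 2 * ((d + E)⁻¹ + (d + (Real.pi - E))⁻¹) := by
  have key : ∀ u ∈ Icc 0 (Real.pi / 2), (Real.sin u + d)⁻¹ ≤ Real.pi / 2 * (d + u)⁻¹ := by
    intro u hu
    have h1 := Real.mul_le_sin hu.1 hu.2
    have hpi := Real.pi_gt_three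
    have h2 : 2 / Real.pi * (d + u) ≤ Real.sin u + d := by
      have : 2 / Real.pi ≤ 1 := by rw [div_le_one Real.pi_pos]; linarith
      nlinarith
    calc (Real.sin u + d)⁻¹ ≤ (2 / Real.pi * (d + u))⁻¹ := by
          have := hu.1
          gcongr
      _ = _ := by rw [mul_inv, inv_div]
  have p1 : 0 ≤ (d + E)⁻¹ := by have := hE.1; positivity
  have p2 : 0 ≤ (d + (Real.pi - E))⁻¹ := by
    have := hE.2
    have : 0 ≤ Real.pi - E := by linarith
    positivity
  have hpi := Real.pi_pos
  rcases le_total E (Real.pi / 2) with h | h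
  · refine (key E ⟨hE.1, h⟩).trans ?_
    gcongr; linarith
  · have := key (Real.pi - E) ⟨by linarith [hE.2], by linarith⟩
    rw [Real.sin_pi_sub] at this
    refine this.trans ?_
    gcongr; linarith

/-- The integrands differ by at most 4B and also by O(d / sin E), with d = ‖x - y‖. Adding the two
bounds gives K d / (sin E + d), whose integral is O(d ln(1/d)). -/
theorem norm_integral_sqrtSumSqDeriv_sub_le_log (hJ : UniformC11On J J' s B)
    (hN : UniformC11On N N' s B) (hs : Convex ℝ s) {m : ℝ} (hm : 0 < m)
    (hlow : ∀ x ∈ s, ∀ E ∈ Icc 0 Real.pi, m * Real.sin E ≤ √(J x E ^ 2 + N x E ^ 2)) :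
    ∃ k, 0 < k ∧ ∀ x ∈ s, ∀ y ∈ s, ‖x - y‖ < 1 / 10 →
      ‖(∫ E in (0 : ℝ)..Real.pi, sqrtSumSqDeriv J N J' N' x E) -
        ∫ E in (0 : ℝ)..Real.pi, sqrtSumSqDeriv J N J' N' y E‖ ≤
        k * ‖x - y‖ * Real.log (1 / ‖x - y‖) := by
  rcases s.eq_empty_or_nonempty with rfl | ⟨x₁, hx₁⟩
  · exact ⟨1, one_pos, by simp⟩
  have hB : 0 ≤ B := hJ.nonneg hx₁
  -- The estimate multiplied by sin E contributes 2B + 6B²/m, the trivial estimate multiplied by d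
  -- contributes 4B.
  set K := 6 * B + 6 * B ^ 2 / m with hK
  have hK0 : 0 ≤ K := by positivity
  refine ⟨6 * Real.pi * K + 1, by have := Real.pi_pos; positivity, fun x hx y hy hxy => ?_⟩
  set d := ‖x - y‖ with hd
  rcases (norm_nonneg (x - y)).eq_or_lt with h | hd0
  · have : x = y := sub_eq_zero.1 (norm_eq_zero.1 h.symm)
    subst this
    simp [hd]
  rw [← hd] at hd0
  have hpt : ∀ E ∈ Icc 0 Real.pi,
      ‖sqrtSumSqDeriv J N J' N' x E - sqrtSumSqDeriv J N J' N' y E‖ ≤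
        K * d * (Real.sin E + d)⁻¹ := by
    intro E hE
    set D := ‖sqrtSumSqDeriv J N J' N' x E - sqrtSumSqDeriv J N J' N' y E‖ with hD
    have hD0 : 0 ≤ D := norm_nonneg _
    have hsin : 0 ≤ Real.sin E := Real.sin_nonneg_of_mem_Icc hE
    have h1 : D ≤ 4 * B := norm_sqrtSumSqDeriv_sub_le hJ hN hx hy hE
    have h2 := norm_sqrtSumSqDeriv_sub_mul_le hJ hN hs hx hy hE
    rw [← hD, ← hd] at h2
    have h3 := hlow x hx E hE
    set S := √(J x E ^ 2 + N x E ^ 2) with hS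
    rw [← div_eq_mul_inv, le_div_iff₀ (by positivity), mul_add]
    have h4 : D * Real.sin E ≤ 2 * B * d + 6 * B ^ 2 / m * d := by
      rcases hsin.eq_or_lt with h0 | h0
      · rw [← h0]; simp; positivity
      have hS0 : 0 < S := lt_of_lt_of_le (by positivity) h3
      have h5 : D ≤ 2 * B * d + 6 * B ^ 2 * d / S := by
        rw [← sub_le_iff_le_add', le_div_iff₀ hS0]; nlinarith
      have hsin1 := Real.sin_le_one E
      have h6 : Real.sin E / S ≤ 1 / m := by
        rw [div_le_div_iff₀ hS0 hm]; linarith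
      calc D * Real.sin E ≤ (2 * B * d + 6 * B ^ 2 * d / S) * Real.sin E := by gcongr
        _ = 2 * B * d * Real.sin E + 6 * B ^ 2 * d * (Real.sin E / S) := by ring
        _ ≤ 2 * B * d * 1 + 6 * B ^ 2 * d * (1 / m) := by gcongr
        _ = _ := by ring
    have h5 : D * d ≤ 4 * B * d := by gcongr
    calc _ ≤ 2 * B * d + 6 * B ^ 2 / m * d + 4 * B * d := by linarith
      _ = K * d := by rw [hK]; ring
  have hpi := Real.pi_pos
  have hc1 : ContinuousOn (fun E => (d + E)⁻¹) (uIcc 0 Real.pi) := by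
    rw [uIcc_of_le hpi.le]
    exact ContinuousOn.inv₀ (by fun_prop) fun E hE => by have := hE.1; positivity
  have hc2 : ContinuousOn (fun E => (d + (Real.pi - E))⁻¹) (uIcc 0 Real.pi) := by
    rw [uIcc_of_le hpi.le]
    exact ContinuousOn.inv₀ (by fun_prop) fun E hE => by
      have : 0 ≤ Real.pi - E := by linarith [hE.2]
      positivity
  have hI1 : ∫ E in (0 : ℝ)..Real.pi, (d + E)⁻¹ = Real.log ((d + Real.pi) / d) := by
    rw [intervalIntegral.integral_comp_add_left (fun u => u⁻¹) d, add_zero,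
      integral_inv_of_pos hd0 (by positivity)]
  have hI2 : ∫ E in (0 : ℝ)..Real.pi, (d + (Real.pi - E))⁻¹ = Real.log ((d + Real.pi) / d) := by
    rw [← hI1, intervalIntegral.integral_comp_sub_left (fun u => (d + u)⁻¹) Real.pi]
    simp
  -- This amounts to (d + π) d² ≤ 1, which is where d < 1/10 is used.
  have hlog : Real.log ((d + Real.pi) / d) ≤ 3 * Real.log (1 / d) := by
    rw [← Real.log_rpow (by positivity)]
    refine Real.log_le_log (by positivity) ?_
    have : ((1 / d) ^ (3 : ℝ) : ℝ) = (1 / d) ^ (3 : ℕ) := by norm_cast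
    rw [this, div_pow, one_pow, div_le_div_iff₀ hd0 (by positivity)]
    have hp4 := Real.pi_le_four
    have : d ^ 2 ≤ 1 / 100 := by nlinarith
    have h7 : (d + Real.pi) * d ^ 2 ≤ 5 * (1 / 100) := by gcongr; linarith
    nlinarith
  rw [← intervalIntegral.integral_sub (intervalIntegrable_sqrtSumSqDeriv hJ hN hx)
    (intervalIntegrable_sqrtSumSqDeriv hJ hN hy)]
  have hlogpos : 0 ≤ Real.log (1 / d) := Real.log_nonneg (by
    rw [le_div_iff₀ hd0]; linarith)
  calc _ ≤ ∫ E in (0 : ℝ)..Real.pi,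
        K * d * (Real.pi / 2) * ((d + E)⁻¹ + (d + (Real.pi - E))⁻¹) := by
        refine intervalIntegral.norm_integral_le_of_norm_le hpi.le ?_ ?_
        · refine Eventually.of_forall fun E hE => ?_
          have hE' := Ioc_subset_Icc_self hE
          refine (hpt E hE').trans ?_
          rw [mul_assoc (K * d)]
          exact mul_le_mul_of_nonneg_left (inv_sin_add_le hd0 hE') (by positivity)
        · exact ((hc1.add hc2).intervalIntegrable).const_mul _
    _ = K * d * (Real.pi / 2) * (2 * Real.log ((d + Real.pi) / d)) := by
        rw [intervalIntegral.integral_const_mul, intervalIntegral.integral_add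
          hc1.intervalIntegrable hc2.intervalIntegrable, hI1, hI2]
        ring
    _ ≤ K * d * (Real.pi / 2) * (2 * (3 * Real.log (1 / d))) := by gcongr
    _ = 3 * Real.pi * K * d * Real.log (1 / d) := by ring
    _ ≤ (6 * Real.pi * K + 1) * d * Real.log (1 / d) := by
        gcongr
        nlinarith [mul_nonneg hpi.le hK0]

/-- With a zero second component the unit vector is the sign of J. Passing from x to y changes J by
at most B‖x - y‖, so the sign can change only on the sublevel set `A`, whose measure is O(√‖x - y‖);
elsewhere only J' varies. -/
theorem norm_integral_sqrtSumSqDeriv_sub_le_sqrt (hJ : UniformC11On J J' s B) (hs : Convex ℝ s)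
    {c : ℝ} (hc : 0 ≤ c)
    (hmeas : ∀ x ∈ s, ∀ ε ≥ 0, volume.real {E ∈ Icc 0 Real.pi | |J x E| ≤ ε} ≤ c * √ε) :
    ∃ k, 0 < k ∧ ∀ x ∈ s, ∀ y ∈ s, ‖x - y‖ < 1 →
      ‖(∫ E in (0 : ℝ)..Real.pi, sqrtSumSqDeriv J (fun _ _ => 0) J' (fun _ _ => 0) x E) -
        ∫ E in (0 : ℝ)..Real.pi, sqrtSumSqDeriv J (fun _ _ => 0) J' (fun _ _ => 0) y E‖ ≤
        k * ‖x - y‖ ^ (1 / 2 : ℝ) := by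
  rcases s.eq_empty_or_nonempty with rfl | ⟨x₁, hx₁⟩
  · exact ⟨1, one_pos, by simp⟩
  have hB : 0 ≤ B := hJ.nonneg hx₁
  have hN : UniformC11On (fun (_ : X) _ => 0) (fun _ _ => 0) s B := UniformC11On.zero hB
  have hpi := Real.pi_pos
  refine ⟨B * Real.pi + 4 * B * (c * √B) + 1, by positivity, fun x hx y hy hxy => ?_⟩
  set d := ‖x - y‖ with hd
  have hd0 : 0 ≤ d := norm_nonneg _
  set A := {E ∈ Icc 0 Real.pi | |J x E| ≤ B * d} with hA
  have hAm : MeasurableSet A := by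
    have := (hJ.continuousOn x hx).abs.preimage_isClosed_of_isClosed isClosed_Icc
      (isClosed_Iic (a := B * d))
    exact this.measurableSet
  have hpt : ∀ E ∈ Icc 0 Real.pi,
      ‖sqrtSumSqDeriv J (fun _ _ => 0) J' (fun _ _ => 0) x E -
        sqrtSumSqDeriv J (fun _ _ => 0) J' (fun _ _ => 0) y E‖ ≤
        B * d + A.indicator (fun _ => 4 * B) E := by
    intro E hE
    by_cases hEA : E ∈ A
    · rw [indicator_of_mem hEA]
      have := norm_sqrtSumSqDeriv_sub_le hJ hN hx hy hE
      have : 0 ≤ B * d := by positivity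
      linarith
    · rw [indicator_of_notMem hEA, add_zero]
      have h1 : B * d < |J x E| := by
        by_contra! h
        exact hEA ⟨hE, h⟩
      have h2 := hJ.abs_sub_le hs hx hy hE
      rw [← hd] at h2
      have h3 : J x E / |J x E| = J y E / |J y E| := by
        have hBd : 0 ≤ B * d := by positivity
        rcases lt_or_ge 0 (J x E) with h | h
        · rw [abs_of_pos h] at h1
          have : 0 < J y E := by linarith [le_abs_self (J x E - J y E)]
          rw [abs_of_pos h, abs_of_pos this, div_self h.ne', div_self this.ne']
        · rw [abs_of_nonpos h] at h1
          have h' : J x E < 0 := by linarith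
          have : J y E < 0 := by linarith [neg_abs_le (J x E - J y E)]
          rw [abs_of_neg h', abs_of_neg this, div_neg, div_neg, div_self h'.ne, div_self this.ne]
      have h4 := hJ.norm_deriv_sub_le x hx y hy E hE
      have h5 : |(J x E / |J x E|)| ≤ 1 := by
        rw [abs_div, abs_abs]; exact div_self_le_one _
      have e : sqrtSumSqDeriv J (fun _ _ => 0) J' (fun _ _ => 0) x E -
        sqrtSumSqDeriv J (fun _ _ => 0) J' (fun _ _ => 0) y E =
          (J x E / |J x E|) • (J' x E - J' y E) := by
        simp [sqrtSumSqDeriv, Real.sqrt_sq_eq_abs, smul_sub, h3]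
      rw [e, norm_smul, Real.norm_eq_abs]
      calc _ ≤ 1 * (B * ‖x - y‖) := by gcongr
        _ = _ := by rw [one_mul]
  rw [← intervalIntegral.integral_sub (intervalIntegrable_sqrtSumSqDeriv hJ hN hx)
    (intervalIntegrable_sqrtSumSqDeriv hJ hN hy)]
  have hAi : IntervalIntegrable (A.indicator fun _ => 4 * B) volume 0 Real.pi := by
    rw [intervalIntegrable_iff_integrableOn_Ioc_of_le hpi.le]
    exact (integrableOn_const (by simp)).indicator hAm
  have hAle : ∫ E in (0 : ℝ)..Real.pi, A.indicator (fun _ => 4 * B) E ≤ 4 * B * (c * √(B * d)) := by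
    rw [intervalIntegral.integral_of_le hpi.le, setIntegral_indicator hAm, setIntegral_const,
      smul_eq_mul, mul_comm]
    gcongr
    refine le_trans ?_ (hmeas x hx (B * d) (by positivity))
    have hAtop : volume A ≠ ⊤ :=
      ((measure_mono (fun _ h => h.1 : A ⊆ Icc 0 Real.pi)).trans_lt measure_Icc_lt_top).ne
    exact measureReal_mono inter_subset_right hAtop
  have hsq : d ≤ √d := by
    rw [Real.le_sqrt hd0 hd0]; nlinarith
  calc _ ≤ ∫ E in (0 : ℝ)..Real.pi, (B * d + A.indicator (fun _ => 4 * B) E) :=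
        intervalIntegral.norm_integral_le_of_norm_le hpi.le
          (Eventually.of_forall fun E hE => hpt E (Ioc_subset_Icc_self hE))
          (intervalIntegrable_const.add hAi)
    _ = Real.pi * (B * d) + ∫ E in (0 : ℝ)..Real.pi, A.indicator (fun _ => 4 * B) E := by
        rw [intervalIntegral.integral_add intervalIntegrable_const hAi,
          intervalIntegral.integral_const, sub_zero, smul_eq_mul]
    _ ≤ Real.pi * (B * √d) + 4 * B * (c * √(B * d)) := by gcongr
    _ = (B * Real.pi + 4 * B * (c * √B)) * √d := by
        rw [Real.sqrt_mul hB]; ring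
    _ ≤ (B * Real.pi + 4 * B * (c * √B) + 1) * √d :=
        mul_le_mul_of_nonneg_right (lt_add_one _).le (Real.sqrt_nonneg _)
    _ = _ := by rw [Real.sqrt_eq_rpow d]

end normIntegral

/-- Analyticity spreads to a compact product neighbourhood by the tube lemma. There the differential
is bounded and locally Lipschitz, hence Lipschitz by compactness. -/
theorem exists_uniformC11On_of_analyticAt {X : Type*} [NormedAddCommGroup X] [NormedSpace ℝ X]
    [ProperSpace X] {F : X × ℝ → ℝ} {x₀ : X}
    (h : ∀ E ∈ Icc 0 Real.pi, AnalyticAt ℝ F (x₀, E)) :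
    ∃ r > 0, ∃ B, UniformC11On (fun x E => F (x, E))
      (fun x E => (fderiv ℝ F (x, E)).comp (ContinuousLinearMap.inl ℝ X ℝ))
      (Metric.ball x₀ r) B := by
  obtain ⟨u, v, hu, -, hxu, hv, huv⟩ := generalized_tube_lemma (isCompact_singleton (x := x₀))
    (isCompact_Icc (a := (0 : ℝ)) (b := Real.pi)) (isOpen_analyticAt ℝ F) (by
      rintro ⟨x, t⟩ ⟨hx, ht⟩
      obtain rfl : x = x₀ := hx
      exact h t ht)
  obtain ⟨r, hr, hru⟩ := Metric.nhds_basis_closedBall.mem_iff.1 (hu.mem_nhds (hxu rfl))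
  set K : Set (X × ℝ) := Metric.closedBall x₀ r ×ˢ Icc 0 Real.pi with hK
  have hKc : IsCompact K := (isCompact_closedBall x₀ r).prod isCompact_Icc
  have hKconv : Convex ℝ K := (convex_closedBall x₀ r).prod (convex_Icc 0 Real.pi)
  have hA : ∀ p ∈ K, AnalyticAt ℝ F p := fun p hp => huv ⟨hru hp.1, hv hp.2⟩
  have hcont : ContinuousOn (fderiv ℝ F) K := fun p hp =>
    (hA p hp).fderiv.continuousAt.continuousWithinAt
  obtain ⟨B₁, hB₁⟩ := hKc.exists_bound_of_continuousOn hcont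
  have hlip : LocallyLipschitzOn K (fderiv ℝ F) := by
    intro p hp
    obtain ⟨C, t, ht, hC⟩ := (hA p hp).fderiv.contDiffAt (n := 1) |>.exists_lipschitzOnWith
    exact ⟨C, t, mem_nhdsWithin_of_mem_nhds ht, hC⟩
  obtain ⟨C, hC⟩ := hlip.exists_lipschitzOnWith_of_compact hKc
  have hmem : ∀ x ∈ Metric.ball x₀ r, ∀ E ∈ Icc 0 Real.pi, (x, E) ∈ K :=
    fun x hx E hE => ⟨Metric.ball_subset_closedBall hx, hE⟩
  have hcomp : ∀ T : X × ℝ →L[ℝ] ℝ, ‖T.comp (ContinuousLinearMap.inl ℝ X ℝ)‖ ≤ ‖T‖ := by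
    intro T
    refine (T.opNorm_comp_le _).trans ?_
    exact mul_le_of_le_one_right (norm_nonneg _) (ContinuousLinearMap.norm_inl_le_one ℝ X ℝ)
  refine ⟨r, hr, max B₁ C, ⟨?_, ?_, ?_, ?_, ?_⟩⟩
  · intro x hx E hE
    have h1 := (hA _ (hmem x hx E hE)).differentiableAt.hasFDerivAt
    exact HasFDerivAt.comp (g := F) x h1 (hasFDerivAt_prodMk_left x E)
  · intro x hx E hE
    have h1 := (hA _ (hmem x hx E hE)).continuousAt
    exact (ContinuousAt.comp (g := F) (f := fun E => (x, E)) h1 (by fun_prop)).continuousWithinAt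
  · intro x hx
    have h1 : ContinuousOn (fun E => fderiv ℝ F (x, E)) (Icc 0 Real.pi) :=
      hcont.comp (f := fun E => (x, E)) (by fun_prop) (fun E hE => hmem x hx E hE)
    exact h1.clm_comp continuousOn_const
  · intro x hx E hE
    exact (hcomp _).trans ((hB₁ _ (hmem x hx E hE)).trans (le_max_left _ _))
  · intro x hx y hy E hE
    rw [← ContinuousLinearMap.sub_comp]
    refine (hcomp _).trans ?_
    have := hC.dist_le_mul _ (hmem x hx E hE) _ (hmem y hy E hE)
    rw [dist_eq_norm] at this
    refine this.trans ?_
    have e : dist ((x, E) : X × ℝ) (y, E) = ‖x - y‖ := by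
      simp [dist_eq_norm]
    rw [e]
    gcongr
    exact le_max_right _ _

/-! ### Tangential and normal components, and the singular curves -/

namespace AveragedTransfer

/-- The linear form in `cos E` whose zeros are those of `tildeJ`. -/
noncomputable def thrustForm (x : ℝ × ℝ) (E : ℝ) : ℝ :=
  (2 * Real.cos x.2 * Real.sin x.1 - Real.sin x.2 * Real.cos x.1) * Real.cos E - Real.cos x.1

/-- The positive weight in front of the linear form in `tildeJ`. -/
noncomputable def weight (x : ℝ × ℝ) (E : ℝ) : ℝ :=
  √((1 - Real.sin x.2 * Real.cos E) / (1 + Real.sin x.2 * Real.cos E))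

/-- The tangential component. -/
noncomputable def tangential (x : ℝ × ℝ) (E : ℝ) : ℝ := weight x E * thrustForm x E

/-- The normal component. -/
noncomputable def normal (x : ℝ × ℝ) (E : ℝ) : ℝ :=
  weight x E * ((1 - Real.sin x.2 * Real.cos E) * Real.sin x.1 * Real.sin E)

/-- The strip covering the cylinder. -/
def strip : Set (ℝ × ℝ) := {x | x.2 ∈ Ioo (-(Real.pi / 2)) (Real.pi / 2)}

theorem cover_mem_cylinder {x : ℝ × ℝ} : cover x ∈ cylinder ↔ x ∈ strip := by
  simp [cover, cylinder, strip]

theorem isOpen_strip : IsOpen strip := isOpen_Ioo.preimage continuous_snd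

theorem tildeJ_eq (x : ℝ × ℝ) (E : ℝ) : tildeJ (x.1 : Real.Angle) x.2 E = tangential x E := by
  simp [tildeJ, tangential, weight, thrustForm]

theorem abs_sin_mul_cos_lt_one {x : ℝ × ℝ} (hx : x ∈ strip) (E : ℝ) :
    |Real.sin x.2 * Real.cos E| < 1 := by
  have h1 : 0 < Real.cos x.2 := Real.cos_pos_of_mem_Ioo hx
  have h2 : |Real.sin x.2| < 1 := by
    rw [← sq_lt_one_iff_abs_lt_one]; nlinarith [Real.sin_sq_add_cos_sq x.2]
  rw [abs_mul]
  exact (mul_le_of_le_one_right (abs_nonneg _) (Real.abs_cos_le_one E)).trans_lt h2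

theorem one_sub_pos {x : ℝ × ℝ} (hx : x ∈ strip) (E : ℝ) : 0 < 1 - Real.sin x.2 * Real.cos E := by
  linarith [(abs_lt.1 (abs_sin_mul_cos_lt_one hx E)).2]

theorem one_add_pos {x : ℝ × ℝ} (hx : x ∈ strip) (E : ℝ) : 0 < 1 + Real.sin x.2 * Real.cos E := by
  linarith [(abs_lt.1 (abs_sin_mul_cos_lt_one hx E)).1]

theorem weight_pos {x : ℝ × ℝ} (hx : x ∈ strip) (E : ℝ) : 0 < weight x E :=
  Real.sqrt_pos.2 (div_pos (one_sub_pos hx E) (one_add_pos hx E))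

/-- The structural identity behind the proof: the integrand of L becomes the norm of a planar vector
that is linear in (cos ψ, sin ψ) and whose first component is the integrand of M without its
absolute value. Once denominators are cleared, only sin² + cos² = 1 in φ and in E is needed. -/
theorem tildeI_eq {x : ℝ × ℝ} (hx : x ∈ strip) (E : ℝ) :
    tildeI (x.1 : Real.Angle) x.2 E = tangential x E ^ 2 + normal x E ^ 2 := by
  have h1 := one_sub_pos hx E
  have h2 := one_add_pos hx E
  have h3 : weight x E ^ 2 = (1 - Real.sin x.2 * Real.cos E) / (1 + Real.sin x.2 * Real.cos E) :=
    Real.sq_sqrt (div_pos h1 h2).le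
  simp only [tangential, normal, mul_pow, h3, Real.sin_sq E, thrustForm, tildeI, alpha11, alpha12,
    alpha22, Real.Angle.cos_coe, Real.Angle.sin_coe]
  field_simp
  have h4 := Real.cos_sq' x.2
  generalize Real.cos x.2 = κ at *
  generalize Real.sin x.2 = σ at *
  generalize Real.cos x.1 = c at *
  generalize Real.sin x.1 = s at *
  generalize Real.cos E = C at *
  linear_combination (-4 * s^2*C^2 * (1 - σ * C)) * h4

/-- The idle `0 ^ 2` casts |T| as the norm of a pair, so that the differentiation lemmas serve L and
M alike. -/
theorem inCoords_M (x : ℝ × ℝ) :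
    inCoords M x = 1 / Real.pi * ∫ E in (0 : ℝ)..Real.pi, √(tangential x E ^ 2 + 0 ^ 2) := by
  simp [inCoords, cover, M, tildeJ_eq, Real.sqrt_sq_eq_abs]

theorem inCoords_L {x : ℝ × ℝ} (hx : x ∈ strip) :
    inCoords L x =
      1 / Real.pi * ∫ E in (0 : ℝ)..Real.pi, √(tangential x E ^ 2 + normal x E ^ 2) := by
  simp [inCoords, cover, L, tildeI_eq hx]

theorem analyticAt_weight {p : (ℝ × ℝ) × ℝ} (hp : p.1 ∈ strip) :
    AnalyticAt ℝ (fun p : (ℝ × ℝ) × ℝ => weight p.1 p.2) p := by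
  refine ContDiffAt.analyticAt ?_
  have h1 := one_sub_pos hp p.2
  have h2 := one_add_pos hp p.2
  refine ContDiffAt.sqrt (ContDiffAt.div ?_ ?_ h2.ne') (div_pos h1 h2).ne'
  · fun_prop
  · fun_prop

theorem analyticAt_thrustForm (p : (ℝ × ℝ) × ℝ) :
    AnalyticAt ℝ (fun p : (ℝ × ℝ) × ℝ => thrustForm p.1 p.2) p := by
  refine ContDiffAt.analyticAt ?_
  unfold thrustForm
  fun_prop

theorem analyticAt_tangential {p : (ℝ × ℝ) × ℝ} (hp : p.1 ∈ strip) :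
    AnalyticAt ℝ (fun p : (ℝ × ℝ) × ℝ => tangential p.1 p.2) p :=
  (analyticAt_weight hp).mul (analyticAt_thrustForm p)

theorem analyticAt_normal {p : (ℝ × ℝ) × ℝ} (hp : p.1 ∈ strip) :
    AnalyticAt ℝ (fun p : (ℝ × ℝ) × ℝ => normal p.1 p.2) p := by
  refine (analyticAt_weight hp).mul ?_
  refine ContDiffAt.analyticAt ?_
  fun_prop

/-- The leading coefficient of `thrustForm` as a polynomial in `cos E`. -/
noncomputable def lead (x : ℝ × ℝ) : ℝ :=
  2 * Real.cos x.2 * Real.sin x.1 - Real.sin x.2 * Real.cos x.1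

theorem thrustForm_eq (x : ℝ × ℝ) (E : ℝ) :
    thrustForm x E = lead x * Real.cos E - Real.cos x.1 := rfl

/-- Clearing denominators in the tangent equations gives conditions saying that the linear form in
cos E vanishes at E = 0 or at E = π. The requirement cos ψ ≠ 0 is then automatic: cos ψ = 0 would
force sin ψ = 0. -/
theorem cover_mem_singularSet {x : ℝ × ℝ} :
    cover x ∈ singularSet ↔
      x ∈ strip ∧ (lead x = Real.cos x.1 ∨ lead x = -Real.cos x.1) := by
  rw [singularSet, mem_ofPred_eq, cover_mem_cylinder]
  refine and_congr_right fun hx => ?_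
  have h1 : 0 < Real.cos x.2 := Real.cos_pos_of_mem_Ioo hx
  have hw := one_add_pos hx 0
  have hu := one_sub_pos hx 0
  rw [Real.cos_zero, mul_one] at hw hu
  have hsc := Real.sin_sq_add_cos_sq x.1
  simp only [cover, Real.Angle.cos_coe, Real.Angle.tan_coe, lead]
  have key : Real.cos x.1 ≠ 0 →
      ((Real.tan x.1 = (1 + Real.sin x.2) / (2 * Real.cos x.2) ∨
        Real.tan x.1 = (-1 + Real.sin x.2) / (2 * Real.cos x.2)) ↔
      (2 * Real.cos x.2 * Real.sin x.1 - Real.sin x.2 * Real.cos x.1 = Real.cos x.1 ∨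
        2 * Real.cos x.2 * Real.sin x.1 - Real.sin x.2 * Real.cos x.1 = -Real.cos x.1)) := by
    intro hc
    rw [Real.tan_eq_sin_div_cos, div_eq_div_iff hc (by positivity),
      div_eq_div_iff hc (by positivity)]
    constructor
    · rintro (h | h)
      · left; linarith
      · right; linarith
    · rintro (h | h)
      · left; linarith
      · right; linarith
  constructor
  · rintro ⟨hc, h⟩
    exact (key hc).1 h
  · intro h
    have hc : Real.cos x.1 ≠ 0 := by
      intro hc
      rw [hc] at h hsc
      have hs : Real.sin x.1 = 0 := by
        rcases h with h | h <;>
        · have : 2 * Real.cos x.2 * Real.sin x.1 = 0 := by linarith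
          simpa [h1.ne'] using this
      simp [hs] at hsc
    exact ⟨hc, (key hc).2 h⟩

theorem cos_ne_zero_of_lead {x : ℝ × ℝ} (hx : x ∈ strip)
    (h : lead x = Real.cos x.1 ∨ lead x = -Real.cos x.1) : Real.cos x.1 ≠ 0 := by
  have := (cover_mem_singularSet.2 ⟨hx, h⟩).2.1
  simpa [cover] using this

theorem lead_ne_zero {x : ℝ × ℝ} (hx : x ∈ strip)
    (h : lead x = Real.cos x.1 ∨ lead x = -Real.cos x.1) : lead x ≠ 0 := by
  have hc := cos_ne_zero_of_lead hx h
  rcases h with h | h <;> simpa [h] using hc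

theorem sin_ne_zero_of_lead {x : ℝ × ℝ} (hx : x ∈ strip)
    (h : lead x = Real.cos x.1 ∨ lead x = -Real.cos x.1) : Real.sin x.1 ≠ 0 := by
  intro hs
  have hc := cos_ne_zero_of_lead hx h
  have hw := one_add_pos hx 0
  have hu := one_sub_pos hx 0
  rw [Real.cos_zero, mul_one] at hw hu
  simp only [lead, hs] at h
  rcases h with h | h
  · have : (1 + Real.sin x.2) * Real.cos x.1 = 0 := by linarith
    simp [hw.ne', hc] at this
  · have : (1 - Real.sin x.2) * Real.cos x.1 = 0 := by linarith
    simp [hu.ne', hc] at this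

theorem cos_eq_one_or_neg_one {E : ℝ} (h : Real.sin E = 0) : Real.cos E = 1 ∨ Real.cos E = -1 := by
  have := Real.sin_sq_add_cos_sq E
  rw [h] at this
  have h2 : (Real.cos E - 1) * (Real.cos E + 1) = 0 := by linear_combination this
  exact (mul_eq_zero.1 h2).imp sub_eq_zero.1 eq_neg_of_add_eq_zero_left

theorem thrustForm_ne_zero_of_sin_eq_zero {x : ℝ × ℝ} (hx : x ∈ strip) (hs : Real.sin x.1 = 0)
    (E : ℝ) : thrustForm x E ≠ 0 := by
  have hc : Real.cos x.1 ≠ 0 := by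
    intro hc
    have := Real.sin_sq_add_cos_sq x.1
    simp [hs, hc] at this
  have h1 := one_add_pos hx E
  have : thrustForm x E = -(Real.cos x.1 * (1 + Real.sin x.2 * Real.cos E)) := by
    rw [thrustForm, hs]; ring
  rw [this]
  exact neg_ne_zero.2 (mul_ne_zero hc h1.ne')

/-! ### Analyticity off the singular curves -/

/-- The normal part vanishes only if sin ψ = 0, where the tangential part has no zero, or if sin E =
0, where a tangential zero places the point on a singular curve. -/
theorem tangential_ne_zero_or_normal_ne_zero {x : ℝ × ℝ} (hx : x ∈ strip)
    (h1 : lead x ≠ Real.cos x.1) (h2 : lead x ≠ -Real.cos x.1) (E : ℝ) :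
    tangential x E ^ 2 + normal x E ^ 2 ≠ 0 := by
  intro h
  have hT : tangential x E = 0 := by nlinarith [sq_nonneg (tangential x E), sq_nonneg (normal x E)]
  have hN : normal x E = 0 := by nlinarith [sq_nonneg (tangential x E), sq_nonneg (normal x E)]
  have hw := (weight_pos hx E).ne'
  have hu := (one_sub_pos hx E).ne'
  simp only [normal, mul_eq_zero, hw, hu, false_or] at hN
  simp only [tangential, mul_eq_zero, hw, false_or] at hT
  rcases hN with hs | hE
  · exact thrustForm_ne_zero_of_sin_eq_zero hx hs E hT
  · rw [thrustForm_eq] at hT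
    rcases cos_eq_one_or_neg_one hE with hE | hE <;> rw [hE] at hT
    · exact h1 (by linarith)
    · exact h2 (by linarith)

theorem analyticAt_inCoords_L {x : ℝ × ℝ} (hx : x ∈ strip) (h1 : lead x ≠ Real.cos x.1)
    (h2 : lead x ≠ -Real.cos x.1) : AnalyticAt ℝ (inCoords L) x := by
  have key : AnalyticAt ℝ (fun x : ℝ × ℝ => 1 / Real.pi *
      ∫ E in (0 : ℝ)..Real.pi, √(tangential x E ^ 2 + normal x E ^ 2)) x := by
    refine analyticAt_const.mul (analyticAt_intervalIntegral_of_forall_mem_Icc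
      (F := fun p => √(tangential p.1 p.2 ^ 2 + normal p.1 p.2 ^ 2)) Real.pi_pos.le
      fun E _ => ?_)
    have := ((analyticAt_tangential (p := (x, E)) hx).pow 2).add
      ((analyticAt_normal (p := (x, E)) hx).pow 2)
    exact (this.contDiffAt.sqrt (tangential_ne_zero_or_normal_ne_zero hx h1 h2 E)).analyticAt
  refine key.congr ?_
  filter_upwards [isOpen_strip.mem_nhds hx] with y hy
  rw [inCoords_L hy]

theorem analyticAt_lead (x : ℝ × ℝ) : AnalyticAt ℝ lead x := by
  refine ContDiffAt.analyticAt ?_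
  unfold lead
  fun_prop

theorem analyticAt_inCoords_M_of_abs_lt {x : ℝ × ℝ} (hx : x ∈ strip)
    (h : |lead x| < |Real.cos x.1|) : AnalyticAt ℝ (inCoords M) x := by
  have key : AnalyticAt ℝ (fun x : ℝ × ℝ => 1 / Real.pi *
      ∫ E in (0 : ℝ)..Real.pi, √(tangential x E ^ 2 + 0 ^ 2)) x := by
    refine analyticAt_const.mul (analyticAt_intervalIntegral_of_forall_mem_Icc
      (F := fun p => √(tangential p.1 p.2 ^ 2 + 0 ^ 2)) Real.pi_pos.le fun E _ => ?_)
    have hne : tangential x E ≠ 0 := by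
      refine mul_ne_zero (weight_pos hx E).ne' fun h0 => ?_
      rw [thrustForm_eq, sub_eq_zero] at h0
      rw [← h0, abs_mul] at h
      exact absurd h (not_lt.2 (mul_le_of_le_one_right (abs_nonneg _) (Real.abs_cos_le_one E)))
    have := ((analyticAt_tangential (p := (x, E)) hx).pow 2).add
      (analyticAt_const (v := (0 : ℝ) ^ 2))
    exact (this.contDiffAt.sqrt (by simpa using hne)).analyticAt
  refine key.congr (Eventually.of_forall fun y => ?_)
  rw [inCoords_M]

theorem continuous_tangential {x : ℝ × ℝ} (hx : x ∈ strip) : Continuous (tangential x) := by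
  rw [continuous_iff_continuousAt]
  exact fun E => ContinuousAt.comp (g := fun p : (ℝ × ℝ) × ℝ => tangential p.1 p.2)
    (f := fun E => (x, E)) (analyticAt_tangential (p := (x, E)) hx).continuousAt (by fun_prop)

/-- The tangential part changes sign once, at α = arccos(cos ψ / `lead`), and σ is the sign of
`lead`. The substitution E = tα fixes the limits of integration, so that the moving zero enters only
through an analytic integrand. -/
theorem integral_abs_tangential {x : ℝ × ℝ} (hx : x ∈ strip) {σ : ℝ} (hσ : |σ| = 1)
    (hpos : 0 < σ * lead x) (h : |Real.cos x.1| < |lead x|) :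
    ∫ E in (0 : ℝ)..Real.pi, √(tangential x E ^ 2 + 0 ^ 2) =
      σ * (2 * (∫ t in (0 : ℝ)..1, Real.arccos (Real.cos x.1 / lead x) *
        tangential x (t * Real.arccos (Real.cos x.1 / lead x))) -
        ∫ E in (0 : ℝ)..Real.pi, tangential x E) := by
  set α := Real.arccos (Real.cos x.1 / lead x) with hα
  have hα0 : 0 ≤ α := Real.arccos_nonneg _
  have hαpi : α ≤ Real.pi := Real.arccos_le_pi _
  have hl : lead x ≠ 0 := by rintro h0; simp [h0] at hpos
  have habs : |Real.cos x.1 / lead x| < 1 := by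
    rw [abs_div, div_lt_one (abs_pos.2 hl)]; exact h
  have hcosα : Real.cos α = Real.cos x.1 / lead x :=
    Real.cos_arccos (abs_lt.1 habs).1.le (abs_lt.1 habs).2.le
  have hcont := continuous_tangential hx
  have hT : ∀ E, σ * tangential x E =
      weight x E * (σ * lead x) * (Real.cos E - Real.cos α) := by
    intro E
    rw [tangential, thrustForm_eq, hcosα]
    field_simp
  have hσσ : σ * σ = 1 := by rw [← abs_mul_abs_self, hσ, one_mul]
  have hTabs : ∀ E, |tangential x E| = |σ * tangential x E| := by
    intro E; rw [abs_mul, hσ, one_mul]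
  have i1 : ∫ E in (0 : ℝ)..α, |tangential x E| = σ * ∫ E in (0 : ℝ)..α, tangential x E := by
    rw [← intervalIntegral.integral_const_mul]
    refine intervalIntegral.integral_congr fun E hE => ?_
    rw [uIcc_of_le hα0] at hE
    rw [hTabs]
    refine abs_of_nonneg ?_
    rw [hT]
    have := Real.cos_le_cos_of_nonneg_of_le_pi hE.1 hαpi hE.2
    exact mul_nonneg (mul_nonneg (weight_pos hx E).le hpos.le) (by linarith)
  have i2 : ∫ E in α..Real.pi, |tangential x E| = -(σ * ∫ E in α..Real.pi, tangential x E) := by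
    rw [← intervalIntegral.integral_const_mul, ← intervalIntegral.integral_neg]
    refine intervalIntegral.integral_congr fun E hE => ?_
    rw [uIcc_of_le hαpi] at hE
    rw [hTabs]
    refine abs_of_nonpos ?_
    rw [hT]
    have := Real.cos_le_cos_of_nonneg_of_le_pi hα0 hE.2 hE.1
    exact mul_nonpos_of_nonneg_of_nonpos (mul_nonneg (weight_pos hx E).le hpos.le) (by linarith)
  have i3 : ∫ t in (0 : ℝ)..1, α * tangential x (t * α) = ∫ E in (0 : ℝ)..α, tangential x E := by
    rw [intervalIntegral.integral_const_mul, intervalIntegral.mul_integral_comp_mul_right]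
    simp
  have i4 := intervalIntegral.integral_add_adjacent_intervals
    (hcont.intervalIntegrable (μ := volume) 0 α) (hcont.intervalIntegrable α Real.pi)
  have i5 := intervalIntegral.integral_add_adjacent_intervals
    (hcont.abs.intervalIntegrable (μ := volume) 0 α) (hcont.abs.intervalIntegrable α Real.pi)
  have i6 : ∫ E in (0 : ℝ)..Real.pi, √(tangential x E ^ 2 + 0 ^ 2) =
      ∫ E in (0 : ℝ)..Real.pi, |tangential x E| := by
    simp [Real.sqrt_sq_eq_abs]
  rw [i6, ← i5, i1, i2, i3, ← i4]
  ring

theorem analyticAt_inCoords_M_of_lt_abs {x : ℝ × ℝ} (hx : x ∈ strip)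
    (h : |Real.cos x.1| < |lead x|) : AnalyticAt ℝ (inCoords M) x := by
  have hl : lead x ≠ 0 := by
    intro h0
    rw [h0, abs_zero] at h
    exact absurd h (not_lt.2 (abs_nonneg _))
  obtain ⟨σ, hσ, hpos⟩ : ∃ σ : ℝ, |σ| = 1 ∧ 0 < σ * lead x := by
    rcases hl.lt_or_gt with h | h
    · exact ⟨-1, by simp, by linarith⟩
    · exact ⟨1, by simp, by linarith⟩
  have habs : |Real.cos x.1 / lead x| < 1 := by
    rw [abs_div, div_lt_one (abs_pos.2 hl)]; exact h
  have hcos : AnalyticAt ℝ (fun x : ℝ × ℝ => Real.cos x.1) x := by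
    refine ContDiffAt.analyticAt ?_
    fun_prop
  have hα : AnalyticAt ℝ (fun x : ℝ × ℝ => Real.arccos (Real.cos x.1 / lead x)) x := by
    refine ContDiffAt.analyticAt ?_
    exact ContDiffAt.comp (g := Real.arccos) (f := fun x : ℝ × ℝ => Real.cos x.1 / lead x) x
      (Real.contDiffAt_arccos (abs_lt.1 habs).1.ne' (abs_lt.1 habs).2.ne)
      (hcos.contDiffAt.div (analyticAt_lead x).contDiffAt hl)
  have key : AnalyticAt ℝ (fun x : ℝ × ℝ => 1 / Real.pi *
      (σ * (2 * (∫ t in (0 : ℝ)..1, Real.arccos (Real.cos x.1 / lead x) *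
        tangential x (t * Real.arccos (Real.cos x.1 / lead x))) -
        ∫ E in (0 : ℝ)..Real.pi, tangential x E))) x := by
    refine analyticAt_const.mul (analyticAt_const.mul
      ((analyticAt_const.mul ?_).sub ?_))
    · refine analyticAt_intervalIntegral_of_forall_mem_Icc
        (F := fun p => Real.arccos (Real.cos p.1.1 / lead p.1) *
        tangential p.1 (p.2 * Real.arccos (Real.cos p.1.1 / lead p.1))) zero_le_one fun t _ => ?_
      have h1 : AnalyticAt ℝ (fun p : (ℝ × ℝ) × ℝ => Real.arccos (Real.cos p.1.1 / lead p.1))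
          (x, t) := AnalyticAt.comp
            (g := fun x : ℝ × ℝ => Real.arccos (Real.cos x.1 / lead x))
            (f := fun p : (ℝ × ℝ) × ℝ => p.1) hα analyticAt_fst
      have h2 := AnalyticAt.comp (f := fun p : (ℝ × ℝ) × ℝ =>
        (p.1, p.2 * Real.arccos (Real.cos p.1.1 / lead p.1))) (x := (x, t))
        (analyticAt_tangential
        (p := (x, t * Real.arccos (Real.cos x.1 / lead x))) hx)
        (analyticAt_fst.prod (analyticAt_snd.mul h1))
      exact h1.mul h2
    · exact analyticAt_intervalIntegral_of_forall_mem_Icc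
        (F := fun p => tangential p.1 p.2) Real.pi_pos.le fun E _ => analyticAt_tangential hx
  refine key.congr ?_
  have e1 : ∀ᶠ y in 𝓝 x, 0 < σ * lead y :=
    (continuousAt_const.mul (analyticAt_lead x).continuousAt).eventually (lt_mem_nhds hpos)
  have e2 : ∀ᶠ y in 𝓝 x, |Real.cos y.1| < |lead y| :=
    hcos.continuousAt.abs.eventually_lt (analyticAt_lead x).continuousAt.abs h
  filter_upwards [isOpen_strip.mem_nhds hx, e1, e2] with y hy h1 h2
  rw [inCoords_M, integral_abs_tangential hy hσ h1 h2]

theorem analyticAt_inCoords_M {x : ℝ × ℝ} (hx : x ∈ strip) (h1 : lead x ≠ Real.cos x.1)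
    (h2 : lead x ≠ -Real.cos x.1) : AnalyticAt ℝ (inCoords M) x := by
  have : |lead x| ≠ |Real.cos x.1| := fun h => (abs_eq_abs.1 h).elim h1 h2
  rcases this.lt_or_gt with h | h
  · exact analyticAt_inCoords_M_of_abs_lt hx h
  · exact analyticAt_inCoords_M_of_lt_abs hx h

end AveragedTransfer

/-! ### From a modulus of continuity to continuous differentiability -/

theorem exists_modulus_nhds {f : ℝ × ℝ → ℝ} {F : ℝ × ℝ → ℝ × ℝ →L[ℝ] ℝ} {x₀ : ℝ × ℝ} {r : ℝ}
    (hr : 0 < r) (hf : ∀ x ∈ Metric.ball x₀ r, HasFDerivAt f (F x) x) {ω : ℝ → ℝ}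
    (hω : ∀ x ∈ Metric.ball x₀ r, ∀ y ∈ Metric.ball x₀ r, ‖x - y‖ < 1 / 10 →
      ‖F x - F y‖ ≤ ω ‖x - y‖) :
    ∃ ρ : ℝ, 0 < ρ ∧ ρ < 1 ∧ (∀ y ∈ Metric.ball x₀ ρ, DifferentiableAt ℝ f y) ∧
      ∀ y ∈ Metric.ball x₀ ρ, ∀ δ : ℝ × ℝ, ‖δ‖ < ρ →
        ‖fderiv ℝ f (y + δ) - fderiv ℝ f y‖ ≤ ω ‖δ‖ := by
  refine ⟨min (r / 2) (1 / 10), by positivity, (min_le_right _ _).trans_lt (by norm_num), ?_, ?_⟩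
  · intro y hy
    exact (hf y (Metric.ball_subset_ball ((min_le_left _ _).trans (by linarith))
      hy)).differentiableAt
  · intro y hy δ hδ
    rw [lt_min_iff] at hδ
    rw [Metric.mem_ball, lt_min_iff] at hy
    have h1 : y ∈ Metric.ball x₀ r := Metric.mem_ball.2 (by linarith [hy.1])
    have h2 : y + δ ∈ Metric.ball x₀ r := by
      have h3 : dist (y + δ) y = ‖δ‖ := by simp [dist_eq_norm]
      have := dist_triangle (y + δ) y x₀
      rw [Metric.mem_ball]
      linarith [hy.1, hδ.1]
    rw [(hf _ h1).fderiv, (hf _ h2).fderiv]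
    have := hω _ h2 _ h1 (by simpa using hδ.2)
    simpa using this

theorem contDiffAt_one_of_modulus {f : ℝ × ℝ → ℝ} {x₀ : ℝ × ℝ} {ρ : ℝ} (hρ : 0 < ρ) {ω : ℝ → ℝ}
    (hω : Tendsto ω (𝓝 0) (𝓝 0)) (hf : ∀ y ∈ Metric.ball x₀ ρ, DifferentiableAt ℝ f y)
    (h : ∀ y ∈ Metric.ball x₀ ρ, ∀ δ : ℝ × ℝ, ‖δ‖ < ρ →
        ‖fderiv ℝ f (y + δ) - fderiv ℝ f y‖ ≤ ω ‖δ‖) : ContDiffAt ℝ 1 f x₀ := by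
  refine contDiffAt_one_iff.2 ⟨fderiv ℝ f, Metric.ball x₀ ρ, Metric.ball_mem_nhds _ hρ, ?_,
    fun x hx => (hf x hx).hasFDerivAt⟩
  intro y hy
  refine ContinuousAt.continuousWithinAt ?_
  rw [ContinuousAt, tendsto_iff_norm_sub_tendsto_zero]
  have h1 : Tendsto (fun z : ℝ × ℝ => ‖z - y‖) (𝓝 y) (𝓝 0) := by
    have : Tendsto (fun z : ℝ × ℝ => ‖z - y‖) (𝓝 y) (𝓝 ‖y - y‖) :=
      (Continuous.tendsto (by fun_prop) y)
    simpa using this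
  refine squeeze_zero' (Eventually.of_forall fun _ => norm_nonneg _) ?_ (hω.comp h1)
  filter_upwards [h1.eventually (gt_mem_nhds hρ)] with z hz
  have := h y hy (z - y) hz
  simpa using this

/-! ### Sublevel sets of forms affine in cos E -/

/-- For a ≤ b, with midpoint m and half-length h, the difference of cosines is 2 sin m sin h. Since
h ≤ m ≤ π - h, sin m ≥ sin h, and Jordan's inequality concludes. The exponent 2 reflects the
critical points 0 and π; it produces the exponent 1/2 for M. -/
theorem two_mul_sq_le_abs_cos_sub_cos {a b : ℝ} (ha : a ∈ Icc 0 Real.pi) (hb : b ∈ Icc 0 Real.pi) :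
    2 * (|a - b| / Real.pi) ^ 2 ≤ |Real.cos a - Real.cos b| := by
  wlog hab : a ≤ b generalizing a b
  · rw [abs_sub_comm, abs_sub_comm (Real.cos a)]
    exact this hb ha (le_of_not_ge hab)
  have hpi := Real.pi_pos
  set h := (b - a) / 2 with hh
  set m := (a + b) / 2 with hm
  have h0 : 0 ≤ h := by linarith
  have h1 : h ≤ Real.pi / 2 := by linarith [ha.1, hb.2]
  have e : Real.cos a - Real.cos b = 2 * Real.sin m * Real.sin h := by
    rw [Real.cos_sub_cos, ← hm, show (a - b) / 2 = -h by rw [hh]; ring, Real.sin_neg]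
    ring
  have hs : 2 / Real.pi * h ≤ Real.sin h := Real.mul_le_sin h0 h1
  have hsm : Real.sin h ≤ Real.sin m := by
    rcases le_total m (Real.pi / 2) with h2 | h2
    · exact Real.sin_le_sin_of_le_of_le_pi_div_two (by linarith) h2 (by linarith [ha.1])
    · rw [← Real.sin_pi_sub m]
      exact Real.sin_le_sin_of_le_of_le_pi_div_two (by linarith) (by linarith)
        (by linarith [hb.2])
  have h2 : 0 ≤ 2 / Real.pi * h := by positivity
  have e2 : |a - b| / Real.pi = 2 / Real.pi * h := by
    rw [abs_sub_comm, abs_of_nonneg (by linarith), hh]; ring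
  rw [e2, e]
  refine le_trans ?_ (le_abs_self _)
  calc 2 * (2 / Real.pi * h) ^ 2 = 2 * (2 / Real.pi * h) * (2 / Real.pi * h) := by ring
    _ ≤ 2 * Real.sin m * Real.sin h := by
      have := hs.trans hsm
      have : 0 ≤ Real.sin m := h2.trans this
      gcongr

/-- The measure is bounded by the diameter, which the previous inequality controls. -/
theorem volume_real_abs_mul_cos_sub_le {l c ε : ℝ} (hl : l ≠ 0) :
    volume.real {E ∈ Icc 0 Real.pi | |l * Real.cos E - c| ≤ ε} ≤ Real.pi * √(ε / |l|) := by
  have hpi := Real.pi_pos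
  refine ENNReal.toReal_le_of_le_ofReal (by positivity) ?_
  refine (Real.volume_le_diam _).trans (Metric.ediam_le fun a ha b hb => ?_)
  rw [edist_dist, Real.dist_eq]
  refine ENNReal.ofReal_le_ofReal ?_
  have h1 := two_mul_sq_le_abs_cos_sub_cos ha.1 hb.1
  have h2 : |Real.cos a - Real.cos b| ≤ 2 * (ε / |l|) := by
    rw [← mul_div_assoc, le_div_iff₀ (abs_pos.2 hl), ← abs_mul]
    have e : (Real.cos a - Real.cos b) * l = (l * Real.cos a - c) - (l * Real.cos b - c) := by ring
    rw [e]
    exact (abs_sub _ _).trans (by linarith [ha.2, hb.2])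
  have h3 : (|a - b| / Real.pi) ^ 2 ≤ ε / |l| := by linarith
  have h4 := Real.le_sqrt_of_sq_le h3
  rw [div_le_iff₀ hpi] at h4
  linarith

theorem norm_inv_pi_smul_sub_le {V : Type*} [NormedAddCommGroup V] [NormedSpace ℝ V] (T S : V) :
    ‖(1 / Real.pi) • T - (1 / Real.pi) • S‖ ≤ ‖T - S‖ := by
  have hpi := Real.pi_gt_three
  rw [← smul_sub, norm_smul, Real.norm_eq_abs, abs_of_pos (by positivity)]
  refine mul_le_of_le_one_left (norm_nonneg _) ?_
  rw [div_le_one (by positivity)]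
  linarith

/-! ### Moduli of continuity of the two differentials -/

namespace AveragedTransfer

theorem exists_pos_le_of_pos {f : (ℝ × ℝ) × ℝ → ℝ} {x₀ : ℝ × ℝ}
    (hf : ∀ x ∈ strip, ∀ E, ContinuousAt f (x, E)) (hx₀ : x₀ ∈ strip)
    (hpos : ∀ x ∈ strip, ∀ E, 0 < f (x, E)) :
    ∃ r > 0, Metric.ball x₀ r ⊆ strip ∧ ∃ m > 0, ∀ x ∈ Metric.ball x₀ r, ∀ E ∈ Icc 0 Real.pi,
      m ≤ f (x, E) := by
  obtain ⟨r, hr, hrs⟩ := Metric.nhds_basis_closedBall.mem_iff.1 (isOpen_strip.mem_nhds hx₀)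
  obtain ⟨m, hm, hmf⟩ := ((isCompact_closedBall x₀ r).prod
    (isCompact_Icc (a := (0 : ℝ)) (b := Real.pi))).exists_forall_le'
    (f := f) (a := 0) (fun p hp => (hf p.1 (hrs hp.1) p.2).continuousWithinAt)
    (fun p hp => hpos p.1 (hrs hp.1) p.2)
  exact ⟨r, hr, Metric.ball_subset_closedBall.trans hrs, m, hm, fun x hx E hE =>
    hmf (x, E) ⟨Metric.ball_subset_closedBall hx, hE⟩⟩

theorem exists_modulus_inCoords_L {x₀ : ℝ × ℝ} (hx₀ : x₀ ∈ strip) (hs : Real.sin x₀.1 ≠ 0) :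
    ∃ k : ℝ, 0 < k ∧ ∃ ρ : ℝ, 0 < ρ ∧ ρ < 1 ∧
      (∀ y ∈ Metric.ball x₀ ρ, DifferentiableAt ℝ (inCoords L) y) ∧
      ∀ y ∈ Metric.ball x₀ ρ, ∀ δ : ℝ × ℝ, ‖δ‖ < ρ →
        ‖differential L (y + δ) - differential L y‖ ≤ k * ‖δ‖ * Real.log (1 / ‖δ‖) := by
  obtain ⟨r₁, hr₁, B₁, hJ⟩ := exists_uniformC11On_of_analyticAt
    (F := fun p : (ℝ × ℝ) × ℝ => tangential p.1 p.2) (x₀ := x₀)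
    (fun E _ => analyticAt_tangential hx₀)
  obtain ⟨r₂, hr₂, B₂, hN⟩ := exists_uniformC11On_of_analyticAt
    (F := fun p : (ℝ × ℝ) × ℝ => normal p.1 p.2) (x₀ := x₀) (fun E _ => analyticAt_normal hx₀)
  obtain ⟨r₃, hr₃, hr₃s, m, hm, hmw⟩ := exists_pos_le_of_pos
    (f := fun p => weight p.1 p.2 * (1 - Real.sin p.1.2 * Real.cos p.2)) (x₀ := x₀)
    (fun x hx E => (analyticAt_weight (p := (x, E)) hx).continuousAt.mul (by fun_prop)) hx₀
    (fun x hx E => mul_pos (weight_pos hx E) (one_sub_pos hx E))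
  have hc : ContinuousAt (fun x : ℝ × ℝ => |Real.sin x.1|) x₀ := by fun_prop
  obtain ⟨r₄, hr₄, hr₄s⟩ := Metric.eventually_nhds_iff_ball.1
    (hc.eventually (lt_mem_nhds (half_lt_self (abs_pos.2 hs))))
  set r := min (min r₁ r₂) (min r₃ r₄) with hrdef
  have hr : 0 < r := by positivity
  have hJ' := hJ.mono (t := Metric.ball x₀ r) (C := max B₁ B₂)
    (Metric.ball_subset_ball ((min_le_left _ _).trans (min_le_left _ _))) (le_max_left _ _)
  have hN' := hN.mono (t := Metric.ball x₀ r) (C := max B₁ B₂)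
    (Metric.ball_subset_ball ((min_le_left _ _).trans (min_le_right _ _))) (le_max_right _ _)
  have hsub₃ : Metric.ball x₀ r ⊆ Metric.ball x₀ r₃ :=
    Metric.ball_subset_ball ((min_le_right _ _).trans (min_le_left _ _))
  have hsub₄ : Metric.ball x₀ r ⊆ Metric.ball x₀ r₄ :=
    Metric.ball_subset_ball ((min_le_right _ _).trans (min_le_right _ _))
  have hm' : 0 < m * (|Real.sin x₀.1| / 2) := by positivity
  -- The normal component alone gives the bound: its factor sin ψ stays away from 0 near x₀.
  have hlow : ∀ x ∈ Metric.ball x₀ r, ∀ E ∈ Icc 0 Real.pi,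
      m * (|Real.sin x₀.1| / 2) * Real.sin E ≤ √(tangential x E ^ 2 + normal x E ^ 2) := by
    intro x hx E hE
    have h1 := hmw x (hsub₃ hx) E hE
    have h2 := hr₄s x (hsub₄ hx)
    have h3 : 0 ≤ Real.sin E := Real.sin_nonneg_of_mem_Icc hE
    refine le_trans ?_ (Real.abs_le_sqrt (show normal x E ^ 2 ≤ _ by
      nlinarith [sq_nonneg (tangential x E)]))
    have hxs := hr₃s (hsub₃ hx)
    have e : |normal x E| =
        weight x E * (1 - Real.sin x.2 * Real.cos E) * |Real.sin x.1| * Real.sin E := by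
      rw [normal, abs_mul, abs_mul, abs_mul, abs_of_pos (weight_pos hxs E),
        abs_of_pos (one_sub_pos hxs E), abs_of_nonneg h3]
      ring
    rw [e]
    dsimp only at h1
    have hnn := hm.le.trans h1
    gcongr
  obtain ⟨k, hk, hmod⟩ := norm_integral_sqrtSumSqDeriv_sub_le_log hJ' hN' (convex_ball x₀ r) hm'
    hlow
  have hpi := Real.pi_gt_three
  obtain ⟨ρ, hρ, hρ1, h⟩ := exists_modulus_nhds (f := inCoords L) hr
    (F := fun x => (1 / Real.pi) • ∫ E in (0 : ℝ)..Real.pi, sqrtSumSqDeriv tangential normal _ _ x E)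
    (ω := fun d => k * d * Real.log (1 / d)) (fun x hx => by
      have hball : Metric.ball x₀ r ∈ 𝓝 x := Metric.isOpen_ball.mem_nhds hx
      have h1 := (hasFDerivAt_integral_sqrt_sum_sq hJ' hN' (convex_ball x₀ r) hball (by
        filter_upwards [Measure.ae_ne volume Real.pi] with E hE hE'
        have h1 : 0 < Real.sin E := Real.sin_pos_of_pos_of_lt_pi hE'.1 (lt_of_le_of_ne hE'.2 hE)
        have h2 := hlow x hx E (Ioc_subset_Icc_self hE')
        have h3 := lt_of_lt_of_le (by positivity) h2
        exact (Real.sqrt_pos.1 h3).ne')).const_mul (1 / Real.pi)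
      refine h1.congr_of_eventuallyEq ?_
      filter_upwards [hball] with y hy
      exact inCoords_L (hr₃s (hsub₃ hy)))
    (fun x hx y hy hxy => by
      exact (norm_inv_pi_smul_sub_le _ _).trans (hmod x hx y hy hxy))
  exact ⟨k, hk, ρ, hρ, hρ1, h⟩

theorem exists_modulus_inCoords_M {x₀ : ℝ × ℝ} (hx₀ : x₀ ∈ strip) (hl : lead x₀ ≠ 0) :
    ∃ k : ℝ, 0 < k ∧ ∃ ρ : ℝ, 0 < ρ ∧ ρ < 1 ∧
      (∀ y ∈ Metric.ball x₀ ρ, DifferentiableAt ℝ (inCoords M) y) ∧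
      ∀ y ∈ Metric.ball x₀ ρ, ∀ δ : ℝ × ℝ, ‖δ‖ < ρ →
        ‖differential M (y + δ) - differential M y‖ ≤ k * ‖δ‖ ^ (1 / 2 : ℝ) := by
  obtain ⟨r₁, hr₁, B, hJ⟩ := exists_uniformC11On_of_analyticAt
    (F := fun p : (ℝ × ℝ) × ℝ => tangential p.1 p.2) (x₀ := x₀)
    (fun E _ => analyticAt_tangential hx₀)
  obtain ⟨r₃, hr₃, hr₃s, m, hm, hmw⟩ := exists_pos_le_of_pos
    (f := fun p => weight p.1 p.2) (x₀ := x₀)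
    (fun x hx E => (analyticAt_weight (p := (x, E)) hx).continuousAt) hx₀
    (fun x hx E => weight_pos hx E)
  have hc : ContinuousAt (fun x : ℝ × ℝ => |lead x|) x₀ := (analyticAt_lead x₀).continuousAt.abs
  obtain ⟨r₄, hr₄, hr₄s⟩ := Metric.eventually_nhds_iff_ball.1
    (hc.eventually (lt_mem_nhds (half_lt_self (abs_pos.2 hl))))
  set r := min r₁ (min r₃ r₄) with hrdef
  have hr : 0 < r := by positivity
  have hJ' := hJ.mono (t := Metric.ball x₀ r) (Metric.ball_subset_ball (min_le_left _ _)) le_rfl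
  have hB := hJ'.nonneg (Metric.mem_ball_self hr)
  have hsub₃ : Metric.ball x₀ r ⊆ Metric.ball x₀ r₃ :=
    Metric.ball_subset_ball ((min_le_right _ _).trans (min_le_left _ _))
  have hsub₄ : Metric.ball x₀ r ⊆ Metric.ball x₀ r₄ :=
    Metric.ball_subset_ball ((min_le_right _ _).trans (min_le_right _ _))
  have hl₀ : 0 < |lead x₀| := abs_pos.2 hl
  have hpi := Real.pi_gt_three
  have hmeas : ∀ x ∈ Metric.ball x₀ r, ∀ ε ≥ 0,
      volume.real {E ∈ Icc 0 Real.pi | |tangential x E| ≤ ε} ≤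
        Real.pi * √(1 / (m * (|lead x₀| / 2))) * √ε := by
    intro x hx ε hε
    have hlx := hr₄s x (hsub₄ hx)
    have hlx0 : lead x ≠ 0 := abs_pos.1 (lt_trans (by positivity) hlx)
    have h1 := volume_real_abs_mul_cos_sub_le (c := Real.cos x.1) (ε := ε / m) hlx0
    refine (measureReal_mono ?_ ((measure_mono
      (fun _ h => h.1 : _ ⊆ Icc 0 Real.pi)).trans_lt measure_Icc_lt_top).ne).trans (h1.trans ?_)
    · rintro E ⟨hE, h2⟩
      refine ⟨hE, ?_⟩
      rw [le_div_iff₀ hm, ← thrustForm_eq]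
      rw [tangential, abs_mul, abs_of_pos (weight_pos (hr₃s (hsub₃ hx)) E)] at h2
      have h3 := hmw x (hsub₃ hx) E hE
      dsimp only at h3
      calc |thrustForm x E| * m ≤ |thrustForm x E| * weight x E := by gcongr
        _ ≤ ε := by linarith
    · rw [mul_assoc, ← Real.sqrt_mul (by positivity)]
      gcongr
      rw [div_div, one_div_mul_eq_div]
      gcongr
  obtain ⟨k, hk, hmod⟩ := norm_integral_sqrtSumSqDeriv_sub_le_sqrt hJ' (convex_ball x₀ r)
    (by positivity) hmeas
  obtain ⟨ρ, hρ, hρ1, h⟩ := exists_modulus_nhds (f := inCoords M) hr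
    (F := fun x => (1 / Real.pi) • ∫ E in (0 : ℝ)..Real.pi,
      sqrtSumSqDeriv tangential (fun _ _ => 0) _ (fun _ _ => 0) x E)
    (ω := fun d => k * d ^ (1 / 2 : ℝ)) (fun x hx => by
      have hball : Metric.ball x₀ r ∈ 𝓝 x := Metric.isOpen_ball.mem_nhds hx
      have h1 := (hasFDerivAt_integral_sqrt_sum_sq hJ' (UniformC11On.zero hB) (convex_ball x₀ r)
        hball (by
        -- At ε = 0 the sublevel bound says that the zeros of the tangential part form a null set.
        have h2 := hmeas x hx 0 le_rfl
        rw [Real.sqrt_zero, mul_zero] at h2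
        have h3 : volume {E ∈ Icc 0 Real.pi | |tangential x E| ≤ 0} = 0 := by
          have h4 := le_antisymm h2 measureReal_nonneg
          rwa [measureReal_eq_zero_iff ((measure_mono
            (fun _ h => h.1 : _ ⊆ Icc 0 Real.pi)).trans_lt measure_Icc_lt_top).ne] at h4
        rw [measure_eq_zero_iff_ae_notMem] at h3
        filter_upwards [h3] with E hE hE' h0
        refine hE ⟨Ioc_subset_Icc_self hE', ?_⟩
        simpa using h0)).const_mul (1 / Real.pi)
      refine h1.congr_of_eventuallyEq (Eventually.of_forall fun y => ?_)
      exact inCoords_M y)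
    (fun x hx y hy hxy => by
      exact (norm_inv_pi_smul_sub_le _ _).trans
        (hmod x hx y hy (hxy.trans (by norm_num))))
  exact ⟨k, hk, ρ, hρ, hρ1, h⟩

end AveragedTransfer

/-! ### Second differences as an obstruction to a Lipschitz differential -/

/-- The second difference of `f` at `x` in the first coordinate direction. -/
noncomputable def secondDiff (f : ℝ × ℝ → ℝ) (x : ℝ × ℝ) (t : ℝ) : ℝ :=
  f (x.1 + t, x.2) + f (x.1 - t, x.2) - 2 * f x

/-- The derivative of s ↦ f(x + s e) + f(x - s e) compares the differential at two points 2s apart,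
so it is at most 2Kt on [0, t]; the mean value inequality gives C = 2K. -/
theorem exists_secondDiff_le_of_lipschitzOnWith {f : ℝ × ℝ → ℝ} {x : ℝ × ℝ} {ρ : ℝ} (hρ : 0 < ρ)
    (hf : ∀ y ∈ Metric.ball x ρ, DifferentiableAt ℝ f y) {K : ℝ≥0} {U : Set (ℝ × ℝ)}
    (hU : U ∈ 𝓝 x) (hK : LipschitzOnWith K (fderiv ℝ f) U) :
    ∃ C : ℝ, ∀ᶠ t in 𝓝[>] (0 : ℝ), secondDiff f x t ≤ C * t ^ 2 := by
  obtain ⟨r, hr, hrU⟩ := Metric.mem_nhds_iff.1 (inter_mem hU (Metric.ball_mem_nhds x hρ))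
  refine ⟨2 * K, ?_⟩
  filter_upwards [Ioo_mem_nhdsGT hr] with t ht
  set e : ℝ × ℝ := (1, 0) with he
  have hen : ‖e‖ = 1 := by simp [he, Prod.norm_def]
  have hball : ∀ s : ℝ, |s| ≤ t → x + s • e ∈ Metric.ball x r := by
    intro s hs
    rw [Metric.mem_ball, dist_eq_norm, add_sub_cancel_left, norm_smul, hen, mul_one]
    exact hs.trans_lt ht.2
  have hd : ∀ s : ℝ, |s| ≤ t →
      HasDerivAt (fun s : ℝ => f (x + s • e)) (fderiv ℝ f (x + s • e) e) s := by
    intro s hs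
    have h1 := (hf _ (hrU (hball s hs)).2).hasFDerivAt
    have h2 : HasDerivAt (fun s : ℝ => x + s • e) e s := by
      simpa using ((hasDerivAt_id s).smul_const e).const_add x
    exact h1.comp_hasDerivAt s h2
  have hd' : ∀ s ∈ Icc 0 t, HasDerivWithinAt (fun s : ℝ => f (x + s • e) + f (x + (-s) • e))
      (fderiv ℝ f (x + s • e) e - fderiv ℝ f (x + (-s) • e) e) (Icc 0 t) s := by
    intro s hs
    have h1 := hd s (by rw [abs_of_nonneg hs.1]; exact hs.2)
    have h2 := hd (-s) (by rw [abs_neg, abs_of_nonneg hs.1]; exact hs.2)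
    have h3 := h2.scomp s (hasDerivAt_neg s)
    have h4 : HasDerivAt (fun s : ℝ => f (x + s • e) + f (x + (-s) • e))
        (fderiv ℝ f (x + s • e) e + (-1 : ℝ) • fderiv ℝ f (x + (-s) • e) e) s := h1.add h3
    rw [neg_one_smul, ← sub_eq_add_neg] at h4
    exact h4.hasDerivWithinAt
  have hbound : ∀ s ∈ Ico 0 t,
      ‖fderiv ℝ f (x + s • e) e - fderiv ℝ f (x + (-s) • e) e‖ ≤ 2 * K * t := by
    intro s hs
    have h1 := hrU (hball s (by rw [abs_of_nonneg hs.1]; exact hs.2.le))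
    have h2 := hrU (hball (-s) (by rw [abs_neg, abs_of_nonneg hs.1]; exact hs.2.le))
    have h3 := hK.dist_le_mul _ h1.1 _ h2.1
    rw [dist_eq_norm, dist_eq_norm] at h3
    have h4 : x + s • e - (x + (-s) • e) = (2 * s) • e := by module
    rw [h4, norm_smul, hen, Real.norm_eq_abs, abs_of_nonneg (by linarith [hs.1])] at h3
    rw [← sub_apply]
    refine (ContinuousLinearMap.le_opNorm _ _).trans ?_
    rw [hen, mul_one]
    refine h3.trans ?_
    have := hs.2.le
    have hK0 : (0 : ℝ) ≤ K := K.2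
    nlinarith
  have := norm_image_sub_le_of_norm_deriv_le_segment' hd' hbound t ⟨ht.1.le, le_rfl⟩
  have e1 : x + t • e = (x.1 + t, x.2) := by ext <;> simp [he]
  have e2 : x + (-t) • e = (x.1 - t, x.2) := by ext <;> simp [he, sub_eq_add_neg]
  rw [e1, e2, neg_zero, zero_smul, add_zero, Real.norm_eq_abs] at this
  have h5 := (le_abs_self _).trans this
  rw [secondDiff]
  linarith

theorem not_lipschitzOnWith_of_secondDiff {f : ℝ × ℝ → ℝ} {x : ℝ × ℝ} {ρ : ℝ} (hρ : 0 < ρ)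
    (hf : ∀ y ∈ Metric.ball x ρ, DifferentiableAt ℝ f y) {ω : ℝ → ℝ}
    (hω : Tendsto ω (𝓝[>] 0) atTop)
    (h : ∀ᶠ t in 𝓝[>] (0 : ℝ), ω t * t ^ 2 ≤ secondDiff f x t) :
    ¬ ∃ K : ℝ≥0, ∃ U ∈ 𝓝 x, LipschitzOnWith K (fderiv ℝ f) U := by
  rintro ⟨K, U, hU, hK⟩
  obtain ⟨C, hC⟩ := exists_secondDiff_le_of_lipschitzOnWith hρ hf hU hK
  obtain ⟨t, h1, h2, h3, ht⟩ := (hC.and (h.and ((hω.eventually (eventually_gt_atTop C)).and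
    eventually_mem_nhdsWithin))).exists
  have ht' : (0 : ℝ) < t := ht
  have : ω t * t ^ 2 ≤ C * t ^ 2 := h2.trans h1
  exact absurd (le_of_mul_le_mul_right this (by positivity)) (not_le.2 h3)

/-- With r the norm, (r - a)(r + a) = b² and r + a ≤ 2R. -/
theorem add_sq_div_le_sqrt {a b R : ℝ} (hR : 0 < R) (h : √(a ^ 2 + b ^ 2) ≤ R) :
    a + b ^ 2 / (2 * R) ≤ √(a ^ 2 + b ^ 2) := by
  set r := √(a ^ 2 + b ^ 2) with hr
  have h1 : r ^ 2 = a ^ 2 + b ^ 2 := Real.sq_sqrt (by positivity)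
  have h2 : |a| ≤ r := Real.abs_le_sqrt (by nlinarith [sq_nonneg b])
  have h3 : a ≤ r := (le_abs_self a).trans h2
  rw [← le_sub_iff_add_le', div_le_iff₀ (by positivity)]
  nlinarith

/-- The gain of the Euclidean norm over linearity along a rotation in the plane spanned by
`(a, b)` and `(a', b')`. -/
theorem le_sqrt_rotation_add {a b a' b' c s : ℝ} (hc : 0 ≤ c) (hc1 : c ≤ 1) (hs : 0 ≤ s)
    (hpos : 0 < a ^ 2 + b ^ 2) :
    2 * c * √(a ^ 2 + b ^ 2) + s ^ 2 * (a * b' - b * a') ^ 2 /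
        ((a ^ 2 + b ^ 2) * (√(a ^ 2 + b ^ 2) + s * √(a' ^ 2 + b' ^ 2))) ≤
      √((c * a + s * a') ^ 2 + (c * b + s * b') ^ 2) +
        √((c * a - s * a') ^ 2 + (c * b - s * b') ^ 2) := by
  set S := √(a ^ 2 + b ^ 2) with hS
  set S' := √(a' ^ 2 + b' ^ 2) with hS'
  have hS0 : 0 < S := Real.sqrt_pos.2 hpos
  have hS2 : S ^ 2 = a ^ 2 + b ^ 2 := Real.sq_sqrt hpos.le
  have hS'0 : 0 ≤ S' := Real.sqrt_nonneg _
  have hS'2 : S' ^ 2 = a' ^ 2 + b' ^ 2 := Real.sq_sqrt (by positivity)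
  set P := a * a' + b * b' with hP
  set D := a * b' - b * a' with hD
  have hPD : P ^ 2 + D ^ 2 = S ^ 2 * S' ^ 2 := by rw [hS2, hS'2, hP, hD]; ring
  have hPabs : |P| ≤ S * S' := by
    exact abs_le_of_sq_le_sq (by nlinarith [sq_nonneg D]) (mul_nonneg hS0.le hS'0)
  have hR : 0 < S + s * S' := by positivity
  -- In the orthonormal frame along (a, b), the rotated vector has longitudinal part cS + σsP/S and
  -- transverse part of size s|D|/S. Summing over σ = ±1 cancels the terms in P and doubles the
  -- transverse gain.
  have key : ∀ σ : ℝ, σ ^ 2 = 1 →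
      c * S + σ * (s * P / S) + (s * D / S) ^ 2 / (2 * (S + s * S')) ≤
        √((c * a + σ * (s * a')) ^ 2 + (c * b + σ * (s * b')) ^ 2) := by
    intro σ hσ
    have e : (c * a + σ * (s * a')) ^ 2 + (c * b + σ * (s * b')) ^ 2 =
        (c * S + σ * (s * P / S)) ^ 2 + (s * D / S) ^ 2 := by
      have e1 : (c * S + σ * (s * P / S)) ^ 2 + (s * D / S) ^ 2 =
        c ^ 2 * S ^ 2 + 2 * c * σ * s * P + s ^ 2 * (σ ^ 2 * P ^ 2 + D ^ 2) / S ^ 2 := by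
        field_simp
        ring
      rw [e1, hσ, one_mul, hPD, mul_div_assoc, mul_div_cancel_left₀ _ (by positivity), hS2, hS'2, hP]
      linear_combination s ^ 2 * (a' ^ 2 + b' ^ 2) * hσ
    rw [e]
    refine add_sq_div_le_sqrt hR ?_
    rw [← e, Real.sqrt_le_left hR.le]
    have hσabs : |σ| = 1 := by
      rw [← sq_eq_sq₀ (abs_nonneg _) zero_le_one, sq_abs, hσ, one_pow]
    have h1 : σ * P ≤ S * S' := by
      refine (le_abs_self _).trans ?_
      rw [abs_mul, hσabs, one_mul]
      exact hPabs
    have e3 : (c * a + σ * (s * a')) ^ 2 + (c * b + σ * (s * b')) ^ 2 =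
        c ^ 2 * S ^ 2 + 2 * (c * s) * (σ * P) + s ^ 2 * S' ^ 2 := by
      rw [hS2, hS'2, hP]
      linear_combination s ^ 2 * (a' ^ 2 + b' ^ 2) * hσ
    rw [e3]
    calc c ^ 2 * S ^ 2 + 2 * (c * s) * (σ * P) + s ^ 2 * S' ^ 2
        ≤ c ^ 2 * S ^ 2 + 2 * (c * s) * (S * S') + s ^ 2 * S' ^ 2 := by gcongr
      _ = (c * S + s * S') ^ 2 := by ring
      _ ≤ (1 * S + s * S') ^ 2 := by gcongr
      _ = (S + s * S') ^ 2 := by ring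
  have k1 := key 1 (by norm_num)
  have k2 := key (-1) (by norm_num)
  simp only [one_mul, neg_one_mul, ← sub_eq_add_neg] at k1 k2
  have e4 : s ^ 2 * D ^ 2 / ((a ^ 2 + b ^ 2) * (S + s * S')) =
      2 * ((s * D / S) ^ 2 / (2 * (S + s * S'))) := by
    rw [← hS2]
    field_simp
  rw [e4]
  linarith

theorem sqrt_rotation_add_ge {a b a' b' c s : ℝ} (hc : 0 ≤ c) (hc1 : c ≤ 1) (hs : 0 ≤ s) :
    2 * c * √(a ^ 2 + b ^ 2) ≤
      √((c * a + s * a') ^ 2 + (c * b + s * b') ^ 2) +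
        √((c * a - s * a') ^ 2 + (c * b - s * b') ^ 2) := by
  rcases (show 0 ≤ a ^ 2 + b ^ 2 by positivity).eq_or_lt with h | h
  · rw [← h, Real.sqrt_zero, mul_zero]; positivity
  · refine le_trans ?_ (le_sqrt_rotation_add (a' := a') (b' := b') hc hc1 hs h)
    have := Real.sqrt_nonneg (a ^ 2 + b ^ 2)
    have : 0 ≤ s ^ 2 * (a * b' - b * a') ^ 2 /
        ((a ^ 2 + b ^ 2) * (√(a ^ 2 + b ^ 2) + s * √(a' ^ 2 + b' ^ 2))) := by positivity
    linarith

/-! ### Rotation in ψ, and the reflection exchanging the curves -/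

namespace AveragedTransfer

theorem weight_mk (x : ℝ × ℝ) (ψ E : ℝ) : weight (ψ, x.2) E = weight x E := rfl

theorem tangential_add (x : ℝ × ℝ) (t E : ℝ) : tangential (x.1 + t, x.2) E =
    Real.cos t * tangential x E + Real.sin t * tangential (x.1 + Real.pi / 2, x.2) E := by
  simp only [tangential, weight_mk, thrustForm, Real.sin_add, Real.cos_add, Real.sin_pi_div_two,
    Real.cos_pi_div_two]
  ring

theorem tangential_sub (x : ℝ × ℝ) (t E : ℝ) : tangential (x.1 - t, x.2) E =
    Real.cos t * tangential x E - Real.sin t * tangential (x.1 + Real.pi / 2, x.2) E := by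
  rw [sub_eq_add_neg, tangential_add, Real.cos_neg, Real.sin_neg]
  ring

theorem normal_add (x : ℝ × ℝ) (t E : ℝ) : normal (x.1 + t, x.2) E =
    Real.cos t * normal x E + Real.sin t * normal (x.1 + Real.pi / 2, x.2) E := by
  simp only [normal, weight_mk, Real.sin_add, Real.sin_pi_div_two, Real.cos_pi_div_two]
  ring

theorem normal_sub (x : ℝ × ℝ) (t E : ℝ) : normal (x.1 - t, x.2) E =
    Real.cos t * normal x E - Real.sin t * normal (x.1 + Real.pi / 2, x.2) E := by
  rw [sub_eq_add_neg, normal_add, Real.cos_neg, Real.sin_neg]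
  ring

/-- This determinant is the numerator of the rotation gain. It does not depend on ψ and vanishes
only to first order at E = 0, which is too slow to compensate the cube of the norm. -/
theorem tangential_mul_normal_sub {x : ℝ × ℝ} (hx : x ∈ strip) (E : ℝ) :
    tangential x E * normal (x.1 + Real.pi / 2, x.2) E -
      normal x E * tangential (x.1 + Real.pi / 2, x.2) E =
      -((1 - Real.sin x.2 * Real.cos E) ^ 2 * Real.sin E) := by
  have h1 := one_sub_pos hx E
  have h2 := one_add_pos hx E
  have h3 : weight x E ^ 2 = (1 - Real.sin x.2 * Real.cos E) / (1 + Real.sin x.2 * Real.cos E) :=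
    Real.sq_sqrt (div_pos h1 h2).le
  simp only [normal, tangential, weight_mk, thrustForm, Real.sin_add_pi_div_two,
    Real.cos_add_pi_div_two]
  have h4 := Real.sin_sq_add_cos_sq x.1
  have h5 : weight x E ^ 2 * (1 + Real.sin x.2 * Real.cos E) = 1 - Real.sin x.2 * Real.cos E := by
    rw [h3]; field_simp
  generalize weight x E = w at *
  linear_combination (-(w ^ 2 * (1 - Real.sin x.2 * Real.cos E) * Real.sin E *
    (1 + Real.sin x.2 * Real.cos E))) * h4 - (1 - Real.sin x.2 * Real.cos E) * Real.sin E * h5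

theorem continuous_normal {x : ℝ × ℝ} (hx : x ∈ strip) : Continuous (normal x) := by
  rw [continuous_iff_continuousAt]
  exact fun E => ContinuousAt.comp (g := fun p : (ℝ × ℝ) × ℝ => normal p.1 p.2)
    (f := fun E => (x, E)) (analyticAt_normal (p := (x, E)) hx).continuousAt (by fun_prop)

theorem continuous_weight {x : ℝ × ℝ} (hx : x ∈ strip) : Continuous (weight x) := by
  rw [continuous_iff_continuousAt]
  exact fun E => ContinuousAt.comp (g := fun p : (ℝ × ℝ) × ℝ => weight p.1 p.2)
    (f := fun E => (x, E)) (analyticAt_weight (p := (x, E)) hx).continuousAt (by fun_prop)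

/-- The reflection exchanging the two components of the singular set. -/
noncomputable def reflect (x : ℝ × ℝ) : ℝ × ℝ := (Real.pi - x.1, -x.2)

theorem reflect_mem_strip {x : ℝ × ℝ} (hx : x ∈ strip) : reflect x ∈ strip :=
  ⟨neg_lt_neg hx.2, by have := neg_lt_neg hx.1; rwa [neg_neg] at this⟩

theorem tangential_reflect (x : ℝ × ℝ) (E : ℝ) :
    tangential (reflect x) (Real.pi - E) = -tangential x E := by
  simp [tangential, reflect, weight, thrustForm]
  ring

theorem normal_reflect (x : ℝ × ℝ) (E : ℝ) : normal (reflect x) (Real.pi - E) = normal x E := by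
  simp [normal, reflect, weight]

theorem inCoords_M_reflect (x : ℝ × ℝ) : inCoords M (reflect x) = inCoords M x := by
  have := intervalIntegral.integral_comp_sub_left (a := 0) (b := Real.pi)
    (fun E => √(tangential (reflect x) E ^ 2 + 0 ^ 2)) Real.pi
  rw [inCoords_M, inCoords_M]
  simp only [tangential_reflect, neg_sq, sub_self, sub_zero] at this
  rw [this]

theorem inCoords_L_reflect {x : ℝ × ℝ} (hx : x ∈ strip) :
    inCoords L (reflect x) = inCoords L x := by
  have := intervalIntegral.integral_comp_sub_left (a := 0) (b := Real.pi)
    (fun E => √(tangential (reflect x) E ^ 2 + normal (reflect x) E ^ 2)) Real.pi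
  rw [inCoords_L hx, inCoords_L (reflect_mem_strip hx)]
  simp only [tangential_reflect, normal_reflect, neg_sq, sub_self, sub_zero] at this
  rw [this]

theorem reflect_add (x : ℝ × ℝ) (t : ℝ) :
    ((reflect x).1 + t, (reflect x).2) = reflect (x.1 - t, x.2) := by
  simp [reflect]; ring

theorem reflect_sub (x : ℝ × ℝ) (t : ℝ) :
    ((reflect x).1 - t, (reflect x).2) = reflect (x.1 + t, x.2) := by
  simp [reflect]; ring

theorem secondDiff_M_reflect (x : ℝ × ℝ) (t : ℝ) :
    secondDiff (inCoords M) (reflect x) t = secondDiff (inCoords M) x t := by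
  rw [secondDiff, secondDiff, reflect_add, reflect_sub]
  simp only [inCoords_M_reflect]
  ring

theorem secondDiff_L_reflect {x : ℝ × ℝ} (hx : x ∈ strip) (t : ℝ) :
    secondDiff (inCoords L) (reflect x) t = secondDiff (inCoords L) x t := by
  rw [secondDiff, secondDiff, reflect_add, reflect_sub, inCoords_L_reflect hx,
    inCoords_L_reflect (x := (x.1 - t, x.2)) hx, inCoords_L_reflect (x := (x.1 + t, x.2)) hx]
  ring

theorem exists_reflect_eq {x : ℝ × ℝ} (hx : x ∈ strip) (h : lead x = -Real.cos x.1) :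
    ∃ y ∈ strip, lead y = Real.cos y.1 ∧ reflect y = x := by
  refine ⟨reflect x, reflect_mem_strip hx, ?_, by simp [reflect]⟩
  simp only [lead, reflect] at h ⊢
  simp
  linarith

theorem exists_weight_le {x : ℝ × ℝ} (hx : x ∈ strip) :
    ∃ W > 0, ∀ E ∈ Icc 0 Real.pi, weight x E ≤ W := by
  obtain ⟨W, hW⟩ := isCompact_Icc.exists_bound_of_continuousOn
    (continuous_weight hx).continuousOn (s := Icc 0 Real.pi)
  refine ⟨W, ?_, fun E hE => (le_abs_self _).trans (hW E hE)⟩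
  have h0 : (0 : ℝ) ∈ Icc 0 Real.pi := ⟨le_rfl, Real.pi_pos.le⟩
  exact (weight_pos hx 0).trans_le ((le_abs_self _).trans (hW 0 h0))

/-! ### Lower bounds for second differences on the curve with zero at E = 0 -/

/-- On this curve the linear form is -cos ψ (1 - cos E), with a second-order zero at E = 0. -/
theorem abs_tangential_le {x : ℝ × ℝ} (hx : x ∈ strip) (h : lead x = Real.cos x.1) {W : ℝ}
    (hW : ∀ E ∈ Icc 0 Real.pi, weight x E ≤ W) {E : ℝ} (hE : E ∈ Icc 0 Real.pi) :
    |tangential x E| ≤ W * E ^ 2 := by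
  have h1 : thrustForm x E = -(Real.cos x.1 * (1 - Real.cos E)) := by
    rw [thrustForm_eq, h]; ring
  have h2 := Real.one_sub_sq_div_two_le_cos (x := E)
  have h3 := Real.cos_le_one E
  have h4 := Real.abs_cos_le_one x.1
  have h5 := weight_pos hx E
  rw [tangential, abs_mul, abs_of_pos h5, h1, abs_neg, abs_mul,
    abs_of_nonneg (by linarith : 0 ≤ 1 - Real.cos E)]
  have h6 := hW E hE
  have h7 : |Real.cos x.1| * (1 - Real.cos E) ≤ 1 * E ^ 2 := by
    gcongr
    · nlinarith
  rw [one_mul] at h7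
  have : 0 ≤ 1 - Real.cos E := by linarith
  have hW0 := h5.le.trans h6
  gcongr

theorem abs_normal_le {x : ℝ × ℝ} (hx : x ∈ strip) {W : ℝ}
    (hW : ∀ E ∈ Icc 0 Real.pi, weight x E ≤ W) {E : ℝ} (hE : E ∈ Icc 0 Real.pi) :
    |normal x E| ≤ W * (2 * E) := by
  have h5 := weight_pos hx E
  have h1 := one_sub_pos hx E
  have h2 := one_add_pos hx E
  have h3 : 0 ≤ Real.sin E := Real.sin_nonneg_of_mem_Icc hE
  have h4 : Real.sin E ≤ E := Real.sin_le hE.1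
  have h6 := Real.abs_sin_le_one x.1
  rw [normal, abs_mul, abs_of_pos h5, abs_mul, abs_mul, abs_of_pos h1, abs_of_nonneg h3]
  have h7 : (1 - Real.sin x.2 * Real.cos E) * |Real.sin x.1| ≤ 2 * 1 := by
    gcongr
    linarith
  rw [mul_one] at h7
  have h8 := hW E hE
  have hW0 := h5.le.trans h8
  gcongr

theorem secondDiff_L_eq {x : ℝ × ℝ} (hx : x ∈ strip) (t : ℝ) :
    secondDiff (inCoords L) x t = 1 / Real.pi * ∫ E in (0 : ℝ)..Real.pi,
      (√(tangential (x.1 + t, x.2) E ^ 2 + normal (x.1 + t, x.2) E ^ 2) +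
        √(tangential (x.1 - t, x.2) E ^ 2 + normal (x.1 - t, x.2) E ^ 2) -
        2 * √(tangential x E ^ 2 + normal x E ^ 2)) := by
  have hi : ∀ y ∈ strip, IntervalIntegrable
      (fun E => √(tangential y E ^ 2 + normal y E ^ 2)) volume 0 Real.pi := fun y hy =>
    Continuous.intervalIntegrable (Real.continuous_sqrt.comp
      (((continuous_tangential hy).pow 2).add ((continuous_normal hy).pow 2))) _ _
  have h1 := hi (x.1 + t, x.2) hx
  have h2 := hi (x.1 - t, x.2) hx
  have h3 := hi x hx
  rw [secondDiff, inCoords_L hx, inCoords_L (x := (x.1 - t, x.2)) hx,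
    inCoords_L (x := (x.1 + t, x.2)) hx, intervalIntegral.integral_sub (h1.add h2) (h3.const_mul 2),
    intervalIntegral.integral_add h1 h2, intervalIntegral.integral_const_mul]
  ring

theorem secondDiff_M_eq {x : ℝ × ℝ} (hx : x ∈ strip) (t : ℝ) :
    secondDiff (inCoords M) x t = 1 / Real.pi * ∫ E in (0 : ℝ)..Real.pi,
      (|tangential (x.1 + t, x.2) E| + |tangential (x.1 - t, x.2) E| - 2 * |tangential x E|) := by
  have hi : ∀ y ∈ strip, IntervalIntegrable
      (fun E => |tangential y E|) volume 0 Real.pi := fun y hy =>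
    (continuous_tangential hy).abs.intervalIntegrable _ _
  have h1 := hi (x.1 + t, x.2) hx
  have h2 := hi (x.1 - t, x.2) hx
  have h3 := hi x hx
  rw [secondDiff, inCoords_M, inCoords_M, inCoords_M,
    intervalIntegral.integral_sub (h1.add h2) (h3.const_mul 2),
    intervalIntegral.integral_add h1 h2, intervalIntegral.integral_const_mul]
  simp [Real.sqrt_sq_eq_abs]
  ring

theorem half_le_sin {t : ℝ} (h0 : 0 ≤ t) (h1 : t ≤ 1) : t / 2 ≤ Real.sin t := by
  have hpi := Real.pi_gt_three
  have h := Real.mul_le_sin h0 (by linarith)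
  refine le_trans ?_ h
  have : (1 : ℝ) / 2 ≤ 2 / Real.pi := by
    rw [div_le_div_iff₀ (by norm_num) Real.pi_pos]
    linarith [Real.pi_le_four]
  nlinarith

/-- For t ≤ E ≤ 1 the rotation gain is at least of order t² · E² / E³. Integrating t²/E over [t, 1]
produces t² ln(1/t), while the factor cos t < 1 loses only O(t²). -/
theorem exists_le_secondDiff_L {x : ℝ × ℝ} (hx : x ∈ strip) (h : lead x = Real.cos x.1) :
    ∃ ω : ℝ → ℝ, Tendsto ω (𝓝[>] 0) atTop ∧
      ∀ᶠ t in 𝓝[>] (0 : ℝ), ω t * t ^ 2 ≤ secondDiff (inCoords L) x t := by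
  obtain ⟨W, hW0, hW⟩ := exists_weight_le hx
  set S : ℝ × ℝ → ℝ → ℝ := fun y E => √(tangential y E ^ 2 + normal y E ^ 2) with hS
  have hScont : ∀ y ∈ strip, Continuous (S y) := fun y hy => Real.continuous_sqrt.comp
      (((continuous_tangential hy).pow 2).add ((continuous_normal hy).pow 2))
  have hS0 : ∀ y E, 0 ≤ S y E := fun y E => Real.sqrt_nonneg _
  set x' : ℝ × ℝ := (x.1 + Real.pi / 2, x.2) with hx'
  have hx's : x' ∈ strip := hx
  obtain ⟨B₁, hB₁⟩ := isCompact_Icc.exists_bound_of_continuousOn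
    (hScont x hx).continuousOn (s := Icc 0 Real.pi)
  obtain ⟨B₂, hB₂⟩ := isCompact_Icc.exists_bound_of_continuousOn
    (hScont x' hx's).continuousOn (s := Icc 0 Real.pi)
  set B := max B₁ B₂ with hB
  have hSB : ∀ E ∈ Icc 0 Real.pi, S x E ≤ B := fun E hE =>
    (le_abs_self _).trans ((hB₁ E hE).trans (le_max_left _ _))
  have hSB' : ∀ E ∈ Icc 0 Real.pi, S x' E ≤ B := fun E hE =>
    (le_abs_self _).trans ((hB₂ E hE).trans (le_max_right _ _))
  have hpi := Real.pi_gt_three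
  have hB0 : 0 ≤ B := (hS0 x 0).trans (hSB 0 ⟨le_rfl, Real.pi_pos.le⟩)
  set m := 1 - |Real.sin x.2| with hm
  have hm0 : 0 < m := by
    have := abs_sin_mul_cos_lt_one hx 0
    rw [Real.cos_zero, mul_one] at this
    linarith
  have hmu : ∀ E, m ≤ 1 - Real.sin x.2 * Real.cos E := by
    intro E
    have h1 : |Real.sin x.2 * Real.cos E| ≤ |Real.sin x.2| := by
      rw [abs_mul]
      exact mul_le_of_le_one_right (abs_nonneg _) (Real.abs_cos_le_one E)
    linarith [(abs_le.1 h1).2]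
  -- 144 = 4 · 4 · 9: sin t ≥ t/2 and sin E ≥ E/2, squared, and the square of S ≤ 3WE.
  set c₀ := m ^ 4 / (144 * W ^ 2 * (3 * W + B)) with hc₀
  have hc₀0 : 0 < c₀ := by positivity
  have hSx : ∀ E ∈ Icc (0 : ℝ) 1, S x E ≤ 3 * W * E := by
    intro E hE
    have hE' : E ∈ Icc 0 Real.pi := ⟨hE.1, hE.2.trans (by linarith)⟩
    have h1 := abs_tangential_le hx h hW hE'
    have h2 := abs_normal_le hx hW hE'
    have h3 : S x E ≤ |tangential x E| + |normal x E| := by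
      have := abs_sqrt_add_sq_sub_le (tangential x E) (normal x E) 0 0
      simp only [sub_zero] at this
      simpa using (le_abs_self _).trans this
    have h4 : E ^ 2 ≤ E := by nlinarith [hE.1, hE.2]
    have h5 : W * E ^ 2 ≤ W * E := by gcongr
    linarith
  refine ⟨fun t => 1 / Real.pi * (c₀ * -Real.log t + -(Real.pi * B)), ?_, ?_⟩
  · exact (tendsto_atTop_add_const_right _ _ ((tendsto_neg_atBot_atTop.comp
      Real.tendsto_log_nhdsGT_zero).const_mul_atTop hc₀0)).const_mul_atTop (by positivity)
  · filter_upwards [Ioo_mem_nhdsGT (zero_lt_one' ℝ)] with t ht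
    have ht0 := ht.1
    have ht1 := ht.2.le
    have hsin : t / 2 ≤ Real.sin t := half_le_sin ht0.le ht1
    have hs0 : 0 ≤ Real.sin t := by linarith
    have hst : Real.sin t ≤ t := Real.sin_le ht0.le
    have hcos : 1 - t ^ 2 / 2 ≤ Real.cos t := Real.one_sub_sq_div_two_le_cos
    have hcos0 : 0 ≤ Real.cos t := by nlinarith
    have hcos1 := Real.cos_le_one t
    set g : ℝ → ℝ := fun E => S (x.1 + t, x.2) E + S (x.1 - t, x.2) E - 2 * S x E with hg
    have hgcont : Continuous g :=
      ((hScont (x.1 + t, x.2) hx).add (hScont (x.1 - t, x.2) hx)).sub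
        (continuous_const.mul (hScont x hx))
    have hrot : ∀ E, S (x.1 + t, x.2) E + S (x.1 - t, x.2) E =
        √((Real.cos t * tangential x E + Real.sin t * tangential x' E) ^ 2 +
          (Real.cos t * normal x E + Real.sin t * normal x' E) ^ 2) +
        √((Real.cos t * tangential x E - Real.sin t * tangential x' E) ^ 2 +
          (Real.cos t * normal x E - Real.sin t * normal x' E) ^ 2) := by
      intro E
      simp only [hS]
      rw [tangential_add, tangential_sub, normal_add, normal_sub]
    have hloss : ∀ E ∈ Icc 0 Real.pi, -(B * t ^ 2) ≤ 2 * Real.cos t * S x E - 2 * S x E := by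
      intro E hE
      have h1 := hSB E hE
      have h2 := hS0 x E
      have h3 : 2 * (1 - Real.cos t) * S x E ≤ t ^ 2 * B := by
        have : 0 ≤ 1 - Real.cos t := by linarith
        gcongr
        linarith
      linarith
    have hnn : ∀ E ∈ Icc 0 Real.pi, 0 ≤ g E + B * t ^ 2 := by
      intro E hE
      have h1 := sqrt_rotation_add_ge (a := tangential x E) (b := normal x E)
        (a' := tangential x' E) (b' := normal x' E) hcos0 hcos1 hs0
      rw [← hrot] at h1
      have h2 := hloss E hE
      simp only [hg]
      linarith
    -- The cut at E ≥ t is used through sin t ≤ E, which makes S + sin t · S' at most (3W + B)E.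
    have hgain : ∀ E ∈ Icc t 1, c₀ * t ^ 2 * E⁻¹ ≤ g E + B * t ^ 2 := by
      intro E hE
      have hE0 : 0 < E := ht0.trans_le hE.1
      have hE' : E ∈ Icc 0 Real.pi := ⟨hE0.le, hE.2.trans (by linarith)⟩
      have hsE : E / 2 ≤ Real.sin E := half_le_sin hE0.le hE.2
      have hD := tangential_mul_normal_sub hx E
      have hDsq : m ^ 4 * (E / 2) ^ 2 ≤ (tangential x E * normal x' E -
          normal x E * tangential x' E) ^ 2 := by
        rw [hD, neg_sq, mul_pow, ← pow_mul]
        have := hmu E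
        have := (one_sub_pos hx E).le
        gcongr
      have hSpos : 0 < tangential x E ^ 2 + normal x E ^ 2 := by
        by_contra! hle
        have e1 : tangential x E = 0 := by
          nlinarith [sq_nonneg (tangential x E), sq_nonneg (normal x E)]
        have e2 : normal x E = 0 := by
          nlinarith [sq_nonneg (tangential x E), sq_nonneg (normal x E)]
        rw [e1, e2] at hDsq
        have : 0 < m ^ 4 * (E / 2) ^ 2 := by positivity
        simp at hDsq
        linarith
      have hS2 : S x E ^ 2 = tangential x E ^ 2 + normal x E ^ 2 := Real.sq_sqrt hSpos.le
      have hSp : 0 < S x E := Real.sqrt_pos.2 hSpos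
      have h1 := le_sqrt_rotation_add (a' := tangential x' E) (b' := normal x' E) hcos0 hcos1 hs0
        hSpos
      rw [← hrot] at h1
      have h2 := hloss E hE'
      have h3 := hSx E ⟨hE0.le, hE.2⟩
      have h4 := hSB' E hE'
      have hq : c₀ * t ^ 2 * E⁻¹ ≤ Real.sin t ^ 2 * (tangential x E * normal x' E -
          normal x E * tangential x' E) ^ 2 / ((tangential x E ^ 2 + normal x E ^ 2) *
          (S x E + Real.sin t * S x' E)) := by
        rw [← hS2]
        calc c₀ * t ^ 2 * E⁻¹ = (t / 2) ^ 2 * (m ^ 4 * (E / 2) ^ 2) /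
              ((3 * W * E) ^ 2 * (3 * W * E + E * B)) := by
              rw [hc₀]; field_simp; ring
          _ ≤ _ := by
            have := hS0 x' E
            have htE := hst.trans hE.1
            gcongr
      simp only [hg]
      change 2 * Real.cos t * S x E + _ / (_ * (S x E + Real.sin t * S x' E)) ≤ _ at h1
      linarith
    have hcont' : Continuous fun E => g E + B * t ^ 2 := hgcont.add continuous_const
    have hinv : IntervalIntegrable (fun E : ℝ => c₀ * t ^ 2 * E⁻¹) volume t 1 := by
      refine ContinuousOn.intervalIntegrable ?_
      rw [uIcc_of_le ht1]
      exact continuousOn_const.mul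
        (ContinuousOn.inv₀ continuousOn_id fun E hE => (ht0.trans_le hE.1).ne')
    have i1 : c₀ * t ^ 2 * -Real.log t ≤ ∫ E in (0 : ℝ)..Real.pi, (g E + B * t ^ 2) := by
      calc c₀ * t ^ 2 * -Real.log t = ∫ E in t..1, c₀ * t ^ 2 * E⁻¹ := by
            rw [intervalIntegral.integral_const_mul, integral_inv_of_pos ht0 one_pos, one_div,
              Real.log_inv]
        _ ≤ ∫ E in t..1, (g E + B * t ^ 2) :=
            intervalIntegral.integral_mono_on ht1 hinv (hcont'.intervalIntegrable _ _) hgain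
        _ ≤ _ := by
            refine intervalIntegral.integral_mono_interval ht0.le ht1 (by linarith) ?_
              (hcont'.intervalIntegrable _ _)
            filter_upwards [self_mem_ae_restrict measurableSet_Ioc] with E hE
            exact hnn E (Ioc_subset_Icc_self hE)
    rw [intervalIntegral.integral_add (hgcont.intervalIntegrable _ _) intervalIntegrable_const,
      intervalIntegral.integral_const, sub_zero, smul_eq_mul] at i1
    rw [secondDiff_L_eq hx, mul_assoc]
    gcongr
    change _ ≤ ∫ E in (0 : ℝ)..Real.pi, g E
    linarith

/-- For E ≤ a√t, |u| + |v| ≥ |u - v| = 2 sin t |T'| is at least mt, because T' does not vanish at E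
= 0, while the subtracted 2|T| is at most mt/2. A gain mt/2 on an interval of length a√t is of order
t^(3/2). -/
theorem exists_le_secondDiff_M {x : ℝ × ℝ} (hx : x ∈ strip) (h : lead x = Real.cos x.1) :
    ∃ ω : ℝ → ℝ, Tendsto ω (𝓝[>] 0) atTop ∧
      ∀ᶠ t in 𝓝[>] (0 : ℝ), ω t * t ^ 2 ≤ secondDiff (inCoords M) x t := by
  obtain ⟨W, hW0, hW⟩ := exists_weight_le hx
  set x' : ℝ × ℝ := (x.1 + Real.pi / 2, x.2) with hx'
  have hx's : x' ∈ strip := hx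
  obtain ⟨B, hB⟩ := isCompact_Icc.exists_bound_of_continuousOn
    (continuous_tangential hx).continuousOn (s := Icc 0 Real.pi)
  have hpi := Real.pi_gt_three
  have hB0 : 0 ≤ B := (abs_nonneg _).trans (hB 0 ⟨le_rfl, Real.pi_pos.le⟩)
  -- At E = 0 the form is linear in (cos ψ, sin ψ) with coefficients -(1 + sin φ) and 2 cos φ. Were
  -- it zero both at ψ and at ψ + π/2, the sum of the squared coefficients would vanish.
  have hT'0 : tangential x' 0 ≠ 0 := by
    refine mul_ne_zero (weight_pos hx's 0).ne' fun h0 => ?_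
    simp only [thrustForm, hx', Real.sin_add_pi_div_two, Real.cos_add_pi_div_two,
      Real.cos_zero] at h0
    have hc := cos_ne_zero_of_lead hx (Or.inl h)
    have hκ : 0 < Real.cos x.2 := Real.cos_pos_of_mem_Ioo hx
    rw [lead] at h
    have : Real.cos x.1 * (4 * Real.cos x.2 ^ 2 + (1 + Real.sin x.2) ^ 2) = 0 := by
      linear_combination 2 * Real.cos x.2 * h0 - (1 + Real.sin x.2) * h
    rcases mul_eq_zero.1 this with h1 | h1
    · exact hc h1
    · have : 0 < 4 * Real.cos x.2 ^ 2 := by positivity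
      nlinarith [sq_nonneg (1 + Real.sin x.2)]
  set m := |tangential x' 0| / 2 with hm
  have hm0 : 0 < m := by positivity
  obtain ⟨η, hη, hηm⟩ := Metric.eventually_nhds_iff_ball.1
    ((continuous_tangential hx's).abs.continuousAt (x := (0 : ℝ)).eventually
      (lt_mem_nhds (half_lt_self (abs_pos.2 hT'0))))
  -- Chosen so that W(a√t)² = mt/4, half of what the gain mt allows for |T|.
  set a := √(m / (4 * W)) with ha
  have ha0 : 0 < a := Real.sqrt_pos.2 (by positivity)
  have ha2 : W * a ^ 2 = m / 4 := by
    rw [ha, Real.sq_sqrt (by positivity)]; field_simp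
  have hsqrt : Tendsto (fun t : ℝ => √t) (𝓝[>] 0) (𝓝[>] 0) := by
    refine tendsto_nhdsWithin_iff.2 ⟨?_, ?_⟩
    · have : Tendsto (fun t : ℝ => √t) (𝓝 0) (𝓝 √0) := Real.continuous_sqrt.tendsto 0
      rw [Real.sqrt_zero] at this
      exact this.mono_left nhdsWithin_le_nhds
    · filter_upwards [self_mem_nhdsWithin] with t ht
      exact Real.sqrt_pos.2 ht
  refine ⟨fun t => 1 / Real.pi * (m / 2 * a * (√t)⁻¹ + -(Real.pi * B)), ?_, ?_⟩
  · exact (tendsto_atTop_add_const_right _ _ ((tendsto_inv_nhdsGT_zero.comp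
      hsqrt).const_mul_atTop (by positivity))).const_mul_atTop (by positivity)
  · have hsmall : ∀ᶠ t in 𝓝[>] (0 : ℝ), √t ∈ Ioo 0 (min (η / a) (Real.pi / a)) :=
      hsqrt.eventually (Ioo_mem_nhdsGT (by positivity))
    filter_upwards [Ioo_mem_nhdsGT (zero_lt_one' ℝ), hsmall] with t ht hts
    have ht0 := ht.1
    have ht1 := ht.2.le
    have hsin : t / 2 ≤ Real.sin t := half_le_sin ht0.le ht1
    have hs0 : 0 ≤ Real.sin t := by linarith
    have hcos : 1 - t ^ 2 / 2 ≤ Real.cos t := Real.one_sub_sq_div_two_le_cos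
    have hcos0 : 0 ≤ Real.cos t := by nlinarith
    have hcos1 := Real.cos_le_one t
    set e := √t * a with he
    have he0 : 0 < e := mul_pos hts.1 ha0
    have heη : e < η := (lt_div_iff₀ ha0).1 (hts.2.trans_le (min_le_left _ _))
    have heπ : e < Real.pi := (lt_div_iff₀ ha0).1 (hts.2.trans_le (min_le_right _ _))
    have he2 : W * e ^ 2 = m / 4 * t := by
      rw [he, mul_pow, Real.sq_sqrt ht0.le, mul_left_comm, ha2]; ring
    set g : ℝ → ℝ := fun E => |tangential (x.1 + t, x.2) E| + |tangential (x.1 - t, x.2) E| -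
      2 * |tangential x E| with hg
    have hgcont : Continuous g :=
      ((continuous_tangential (x := (x.1 + t, x.2)) hx).abs.add
        (continuous_tangential (x := (x.1 - t, x.2)) hx).abs).sub
        (continuous_const.mul (continuous_tangential hx).abs)
    have hnn : ∀ E ∈ Icc 0 Real.pi, 0 ≤ g E + B * t ^ 2 := by
      intro E hE
      have h1 := abs_add_le (tangential (x.1 + t, x.2) E) (tangential (x.1 - t, x.2) E)
      have h2 : tangential (x.1 + t, x.2) E + tangential (x.1 - t, x.2) E =
          2 * Real.cos t * tangential x E := by
        rw [tangential_add, tangential_sub]; ring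
      rw [h2, abs_mul, abs_of_nonneg (by positivity : 0 ≤ 2 * Real.cos t)] at h1
      have h3 : |tangential x E| ≤ B := hB E hE
      have h4 : 2 * (1 - Real.cos t) * |tangential x E| ≤ t ^ 2 * B := by
        have : 0 ≤ 1 - Real.cos t := by linarith
        gcongr
        linarith
      simp only [hg]
      linarith
    have hgain : ∀ E ∈ Icc 0 e, m / 2 * t ≤ g E + B * t ^ 2 := by
      intro E hE
      have h1 := abs_sub (tangential (x.1 + t, x.2) E) (tangential (x.1 - t, x.2) E)
      have h2 : tangential (x.1 + t, x.2) E - tangential (x.1 - t, x.2) E =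
          2 * Real.sin t * tangential x' E := by
        rw [tangential_add, tangential_sub]; ring
      rw [h2, abs_mul, abs_of_nonneg (by positivity : 0 ≤ 2 * Real.sin t)] at h1
      have h3 : m < |tangential x' E| := hηm E (by
        rw [Metric.mem_ball, dist_zero_right, Real.norm_eq_abs, abs_of_nonneg hE.1]
        exact hE.2.trans_lt heη)
      have h4 := abs_tangential_le hx h hW (E := E) ⟨hE.1, hE.2.trans heπ.le⟩
      have h5 : W * E ^ 2 ≤ W * e ^ 2 := by
        have := hE.1
        have := hE.2
        gcongr
      have h6 : 2 * (t / 2) * m ≤ 2 * Real.sin t * |tangential x' E| := by gcongr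
      have h7 : 0 ≤ B * t ^ 2 := by positivity
      simp only [hg]
      linarith
    have hcont' : Continuous fun E => g E + B * t ^ 2 := hgcont.add continuous_const
    have i1 : e * (m / 2 * t) ≤ ∫ E in (0 : ℝ)..Real.pi, (g E + B * t ^ 2) := by
      calc e * (m / 2 * t) = ∫ E in (0 : ℝ)..e, m / 2 * t := by
            rw [intervalIntegral.integral_const, sub_zero, smul_eq_mul]
        _ ≤ ∫ E in (0 : ℝ)..e, (g E + B * t ^ 2) :=
            intervalIntegral.integral_mono_on he0.le intervalIntegrable_const
              (hcont'.intervalIntegrable _ _) hgain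
        _ ≤ _ := by
            refine intervalIntegral.integral_mono_interval le_rfl he0.le heπ.le ?_
              (hcont'.intervalIntegrable _ _)
            filter_upwards [self_mem_ae_restrict measurableSet_Ioc] with E hE
            exact hnn E (Ioc_subset_Icc_self hE)
    rw [intervalIntegral.integral_add (hgcont.intervalIntegrable _ _) intervalIntegrable_const,
      intervalIntegral.integral_const, sub_zero, smul_eq_mul] at i1
    have hst : (√t)⁻¹ * t ^ 2 = √t * t := by
      have := hts.1.ne'
      have h8 : √t * √t = t := Real.mul_self_sqrt ht0.le
      field_simp
      rw [sq √t, h8]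
    rw [secondDiff_M_eq hx, mul_assoc]
    gcongr
    change _ ≤ ∫ E in (0 : ℝ)..Real.pi, g E
    have e9 : (m / 2 * a * (√t)⁻¹ + -(Real.pi * B)) * t ^ 2 =
        e * (m / 2 * t) - Real.pi * (B * t ^ 2) := by
      rw [he]
      linear_combination (m / 2 * a) * hst
    linarith

/-! ### Conclusions on the whole cylinder -/

theorem not_lipschitz_differential_L {x : ℝ × ℝ} (hx : cover x ∈ singularSet) :
    ¬ ∃ K : ℝ≥0, ∃ U ∈ 𝓝 x, LipschitzOnWith K (differential L) U := by
  obtain ⟨hxs, hl⟩ := cover_mem_singularSet.1 hx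
  obtain ⟨k, -, ρ, hρ, -, hd, -⟩ := exists_modulus_inCoords_L hxs (sin_ne_zero_of_lead hxs hl)
  obtain ⟨ω, hω, h⟩ : ∃ ω : ℝ → ℝ, Tendsto ω (𝓝[>] 0) atTop ∧
      ∀ᶠ t in 𝓝[>] (0 : ℝ), ω t * t ^ 2 ≤ secondDiff (inCoords L) x t := by
    rcases hl with hl | hl
    · exact exists_le_secondDiff_L hxs hl
    · obtain ⟨y, hy, hly, rfl⟩ := exists_reflect_eq hxs hl
      simpa only [secondDiff_L_reflect hy] using exists_le_secondDiff_L hy hly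
  exact not_lipschitzOnWith_of_secondDiff hρ hd hω h

theorem not_lipschitz_differential_M {x : ℝ × ℝ} (hx : cover x ∈ singularSet) :
    ¬ ∃ K : ℝ≥0, ∃ U ∈ 𝓝 x, LipschitzOnWith K (differential M) U := by
  obtain ⟨hxs, hl⟩ := cover_mem_singularSet.1 hx
  obtain ⟨k, -, ρ, hρ, -, hd, -⟩ := exists_modulus_inCoords_M hxs (lead_ne_zero hxs hl)
  obtain ⟨ω, hω, h⟩ : ∃ ω : ℝ → ℝ, Tendsto ω (𝓝[>] 0) atTop ∧
      ∀ᶠ t in 𝓝[>] (0 : ℝ), ω t * t ^ 2 ≤ secondDiff (inCoords M) x t := by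
    rcases hl with hl | hl
    · exact exists_le_secondDiff_M hxs hl
    · obtain ⟨y, hy, hly, rfl⟩ := exists_reflect_eq hxs hl
      simpa only [secondDiff_M_reflect] using exists_le_secondDiff_M hy hly
  exact not_lipschitzOnWith_of_secondDiff hρ hd hω h

theorem contDiffAt_inCoords_L {x : ℝ × ℝ} (hx : x ∈ strip) : ContDiffAt ℝ 1 (inCoords L) x := by
  by_cases hl : lead x = Real.cos x.1 ∨ lead x = -Real.cos x.1
  · obtain ⟨k, -, ρ, hρ, -, hd, h⟩ := exists_modulus_inCoords_L hx (sin_ne_zero_of_lead hx hl)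
    refine contDiffAt_one_of_modulus (ω := fun d => k * d * Real.log (1 / d)) hρ ?_ hd h
    -- The modulus is -k d ln d, which with the convention ln 0 = 0 is continuous at 0 with value 0.
    have h1 : Continuous fun d : ℝ => -(k * (d * Real.log d)) :=
      (continuous_const.mul Real.continuous_mul_log).neg
    have h2 := h1.tendsto 0
    simp only [zero_mul, mul_zero, neg_zero] at h2
    refine h2.congr fun d => ?_
    rw [one_div, Real.log_inv]
    ring
  · push Not at hl
    exact (analyticAt_inCoords_L hx hl.1 hl.2).contDiffAt

theorem contDiffAt_inCoords_M {x : ℝ × ℝ} (hx : x ∈ strip) : ContDiffAt ℝ 1 (inCoords M) x := by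
  by_cases hl : lead x = Real.cos x.1 ∨ lead x = -Real.cos x.1
  · obtain ⟨k, -, ρ, hρ, -, hd, h⟩ := exists_modulus_inCoords_M hx (lead_ne_zero hx hl)
    refine contDiffAt_one_of_modulus (ω := fun d => k * d ^ (1 / 2 : ℝ)) hρ ?_ hd h
    have h1 : Continuous fun d : ℝ => k * d ^ (1 / 2 : ℝ) :=
      continuous_const.mul (Real.continuous_rpow_const (by norm_num))
    simpa using h1.tendsto 0
  · push Not at hl
    exact (analyticAt_inCoords_M hx hl.1 hl.2).contDiffAt

end AveragedTransfer

theorem proposition2 :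
    -- real analytic on the cylinder away from the singular set
    (∀ x : ℝ × ℝ, AveragedTransfer.cover x ∈
        AveragedTransfer.cylinder \ AveragedTransfer.singularSet →
      AnalyticAt ℝ (AveragedTransfer.inCoords AveragedTransfer.L) x ∧
      AnalyticAt ℝ (AveragedTransfer.inCoords AveragedTransfer.M) x) ∧
    -- continuously differentiable on the whole cylinder
    ContDiffOn ℝ 1 (AveragedTransfer.inCoords AveragedTransfer.L)
      (AveragedTransfer.cover ⁻¹' AveragedTransfer.cylinder) ∧
    ContDiffOn ℝ 1 (AveragedTransfer.inCoords AveragedTransfer.M)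
      (AveragedTransfer.cover ⁻¹' AveragedTransfer.cylinder) ∧
    -- behaviour of the differentials at every point of the singular set
    (∀ x : ℝ × ℝ, AveragedTransfer.cover x ∈ AveragedTransfer.singularSet →
      -- not Lipschitz on any neighbourhood of the point
      (¬ ∃ K : ℝ≥0, ∃ U ∈ 𝓝 x,
        LipschitzOnWith K (AveragedTransfer.differential AveragedTransfer.L) U) ∧
      (¬ ∃ K : ℝ≥0, ∃ U ∈ 𝓝 x,
        LipschitzOnWith K (AveragedTransfer.differential AveragedTransfer.M) U) ∧
      -- modulus of continuity of the differentials near the point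
      (∃ k : ℝ, 0 < k ∧ ∃ r : ℝ, 0 < r ∧ r < 1 ∧ ∀ y ∈ Metric.ball x r, ∀ δ : ℝ × ℝ, ‖δ‖ < r →
        ‖AveragedTransfer.differential AveragedTransfer.L (y + δ)
            - AveragedTransfer.differential AveragedTransfer.L y‖
          ≤ k * ‖δ‖ * Real.log (1 / ‖δ‖)) ∧
      (∃ k : ℝ, 0 < k ∧ ∃ r : ℝ, 0 < r ∧ r < 1 ∧ ∀ y ∈ Metric.ball x r, ∀ δ : ℝ × ℝ, ‖δ‖ < r →
        ‖AveragedTransfer.differential AveragedTransfer.M (y + δ)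
            - AveragedTransfer.differential AveragedTransfer.M y‖
          ≤ k * ‖δ‖ ^ (1 / 2 : ℝ))) := by
  open AveragedTransfer in
  refine ⟨fun x hx => ?_, fun x hx => ?_, fun x hx => ?_, fun x hx => ⟨?_, ?_, ?_, ?_⟩⟩
  · have hxs : x ∈ strip := cover_mem_cylinder.1 hx.1
    have hn : ¬ (lead x = Real.cos x.1 ∨ lead x = -Real.cos x.1) := fun h =>
      hx.2 (cover_mem_singularSet.2 ⟨hxs, h⟩)
    push Not at hn
    exact ⟨analyticAt_inCoords_L hxs hn.1 hn.2, analyticAt_inCoords_M hxs hn.1 hn.2⟩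
  · exact (contDiffAt_inCoords_L (cover_mem_cylinder.1 hx)).contDiffWithinAt
  · exact (contDiffAt_inCoords_M (cover_mem_cylinder.1 hx)).contDiffWithinAt
  · exact not_lipschitz_differential_L hx
  · exact not_lipschitz_differential_M hx
  · obtain ⟨hxs, hl⟩ := cover_mem_singularSet.1 hx
    obtain ⟨k, hk, r, hr, hr1, -, h⟩ := exists_modulus_inCoords_L hxs (sin_ne_zero_of_lead hxs hl)
    exact ⟨k, hk, r, hr, hr1, h⟩
  · obtain ⟨hxs, hl⟩ := cover_mem_singularSet.1 hx
    obtain ⟨k, hk, r, hr, hr1, -, h⟩ := exists_modulus_inCoords_M hxs (lead_ne_zero hxs hl)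
    exact ⟨k, hk, r, hr, hr1, h⟩
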